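/- Let $K$ be a field of characteristic zero, let $m\ge 2$, and let $A=K+\sum_{i\ge m}Kx^i\subseteq K[x]$. Let $\mathcal D(A)\subseteq \mathrm{End}_K(A)$ be the algebra of ($K$-linear, Grothendieck) differential operators on $A$. Put $h=\partial x\in\mathcal D(A)$ (that is, $h(p)=(xp)'$), $D=K[h]$, and let $\sigma$ be the automorphism of $D$ and of $K(h)$ with $\sigma(h)=h-1$. Let $B=K(h)[x,x^{-1};\sigma]$ be the skew Laurent polynomial ring ($xf=\sigma(f)x$). Let $K[h][x,x^{-1};\sigma]\subseteq B$ act on $K[x,x^{-1}]$ by multiplication by $x$ and by $h=\partial x$; then every $\delta\in\mathcal D(A)$ is the restriction to $A$ of the action of a unique element of $K[h][x,x^{-1};\sigma]$, and in this way $\mathcal D(A)$ is regarded as a subring of $B$. Modules are left modules. A $\mathcal D(A)$-module is $D$-torsion free if no nonzero element of $D$ annihilates a nonzero element of it. For maximal ideals $\mathfrak p,\mathfrak q$ of $D$ in the same $\sigma$-orbit write $\mathfrak p<\mathfrak q$ if $\mathfrak q=\sigma^i(\mathfrak p)$ for some $i>0$. For $\alpha,\beta\in D$ write $\alpha<\beta$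 if $\mathfrak p<\mathfrak q$ for all maximal ideals $\mathfrak p\ni\alpha$, $\mathfrak q\ni\beta$ of $D$ that lie in the same $\sigma$-orbit. Let $\delta_{-1}=h(h-m)x^{-1}$, $\delta_1=(h-2)x$, $a=\delta_{-1}\delta_1=h(h-1)(h-m)$, and let $\mathbb A$ be the subalgebra of $\mathcal D(A)$ generated by $h,\delta_1,\delta_{-1}$. An element $b\in \mathbb A$ is called $\mathbb A$-normal if $b=\delta_{-1}^{n}\beta_{-n}+\delta_{-1}^{n-1}\beta_{-n+1}+\cdots+\beta_0$ with $n\ge1$, all $\beta_{i}\in D$, $\beta_{-n}\neq0$, $\beta_0\ne0$, $\beta_0<\beta_{-n}$ and $\beta_0<a$. Elements $b,c\in B$ are called similar if there is $d\in B$ such that $1$ is a greatest common right divisor of $c$ and $d$, and $bd$ is a least common left multiple of $c$ and $d$. For $b \in B$ put $M_b=\mathcal D(A)/(\mathcal D(A)\cap Bb)$. **Theorem.** The simple $D$-torsion free $\mathcal D(A)$-modules are, up to isomorphism, exactly the modules $M_b$ where $b$ is an $\mathbb A$-normal element which is irreducible in $B$: each such $M_b$ is simple and $D$-torsion free, and each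 simple $D$-torsion free $\mathcal D(A)$-module is isomorphic to some such $M_b$. For $\mathbb A$-normal irreducible elements $b,b'$ of $B$, the $\mathcal D(A)$-modules $M_b$ and $M_{b'}$ are isomorphic if and only if $b$ and $b'$ are similar. -/

import Mathlib

open Polynomial
open scoped LaurentPolynomial

noncomputable section

namespace CuspDiff

universe u

section DiffOps

variable (K : Type*) (A : Type*) [CommRing K] [CommRing A] [Algebra K A]

/-- The `K`-linear map `p ↦ δ (a p) - a δ (p)`, that is, the commutator of `δ` with the
multiplication by `a`. -/
def commMul (δ : Module.End K A) (a : A) : Module.End K A :=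
  δ * LinearMap.mulLeft K a - LinearMap.mulLeft K a * δ

variable {K A} in
/-- `IsDiffOpLT n δ`: `δ` is a `K`-linear differential operator on `A` of order `< n`
(in the sense of Grothendieck). -/
def IsDiffOpLT : ℕ → Module.End K A → Prop
  | 0, δ => δ = 0
  | n + 1, δ => ∀ a : A, IsDiffOpLT n (commMul K A δ a)

variable {K A}

theorem commMul_apply (δ : Module.End K A) (a p : A) :
    commMul K A δ a p = δ (a * p) - a * δ p := rfl

theorem isDiffOpLT_zero (n : ℕ) : IsDiffOpLT n (0 : Module.End K A) := by
  induction n with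
  | zero => rfl
  | succ n ih =>
    intro a
    have : commMul K A 0 a = 0 := by simp [commMul]
    rwa [this]

theorem IsDiffOpLT.add {n : ℕ} {δ ε : Module.End K A} (h : IsDiffOpLT n δ)
    (h' : IsDiffOpLT n ε) : IsDiffOpLT n (δ + ε) := by
  induction n generalizing δ ε with
  | zero => simp_all [IsDiffOpLT]
  | succ n ih =>
    intro a
    have : commMul K A (δ + ε) a = commMul K A δ a + commMul K A ε a := by
      simp only [commMul, add_mul, mul_add]; abel
    rw [this]
    exact ih (h a) (h' a)

theorem IsDiffOpLT.succ {n : ℕ} {δ : Module.End K A} (h : IsDiffOpLT n δ) :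
    IsDiffOpLT (n + 1) δ := by
  induction n generalizing δ with
  | zero => intro a; rw [show δ = 0 from h]; simp [commMul, IsDiffOpLT]
  | succ n ih => exact fun a => ih (h a)

theorem IsDiffOpLT.mono {n k : ℕ} (hnk : n ≤ k) {δ : Module.End K A} (h : IsDiffOpLT n δ) :
    IsDiffOpLT k δ := by
  induction hnk with
  | refl => exact h
  | step _ ih => exact ih.succ

theorem IsDiffOpLT.mul {n k : ℕ} {δ ε : Module.End K A} (h : IsDiffOpLT n δ)
    (h' : IsDiffOpLT k ε) : IsDiffOpLT (n + k) (δ * ε) := by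
  obtain ⟨s, hs⟩ : ∃ s, n + k = s := ⟨_, rfl⟩
  induction s generalizing n k δ ε with
  | zero =>
    obtain ⟨rfl, rfl⟩ : n = 0 ∧ k = 0 := by omega
    simp_all [IsDiffOpLT]
  | succ s ih =>
    rcases n with _ | n
    · rw [show δ = 0 from h, zero_mul]; exact isDiffOpLT_zero _
    rcases k with _ | k
    · rw [show ε = 0 from h', mul_zero]; exact isDiffOpLT_zero _
    intro a
    have : commMul K A (δ * ε) a = δ * commMul K A ε a + commMul K A δ a * ε := by
      simp only [commMul, sub_mul, mul_sub, mul_assoc]; abel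
    rw [this]
    refine IsDiffOpLT.add (n := n + 1 + k) ?_ ?_
    · exact ih h (h' a) (by omega)
    · have := ih (h a) h' (by omega)
      rwa [show n + (k + 1) = n + 1 + k by omega] at this

theorem isDiffOpLT_algebraMap (c : K) :
    IsDiffOpLT 1 (algebraMap K (Module.End K A) c) := by
  intro a
  ext p
  simp [commMul]

variable (K A) in
/-- The algebra `𝒟(A)` of `K`-linear differential operators on the commutative algebra `A`. -/
def diffOps : Subalgebra K (Module.End K A) where
  carrier := {δ | ∃ n, IsDiffOpLT n δ}
  mul_mem' := fun ⟨_, h⟩ ⟨_, h'⟩ => ⟨_, h.mul h'⟩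
  add_mem' := fun ⟨_, h⟩ ⟨_, h'⟩ =>
    ⟨_, (h.mono (le_max_left _ _)).add (h'.mono (le_max_right _ _))⟩
  algebraMap_mem' := fun c => ⟨1, isDiffOpLT_algebraMap c⟩

instance instRingDiffOps : Ring (diffOps K A) := inferInstance

end DiffOps

variable (K : Type u) [Field K]

/-- The generalized cusp algebra `A(m) = K + ∑_{i ≥ m} K x^i`. -/
def cusp (m : ℕ) : Subalgebra K K[X] where
  carrier := {p | ∀ i, 0 < i → i < m → p.coeff i = 0}
  mul_mem' := by
    intro p q hp hq i hi him
    rw [coeff_mul]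
    refine Finset.sum_eq_zero fun x hx => ?_
    have hx' := Finset.HasAntidiagonal.mem_antidiagonal.1 hx
    rcases Nat.eq_zero_or_pos x.1 with h | h
    · rw [hq x.2 (by omega) (by omega), mul_zero]
    · rw [hp x.1 h (by omega), zero_mul]
  add_mem' := by
    intro p q hp hq i hi him
    rw [coeff_add, hp i hi him, hq i hi him, add_zero]
  algebraMap_mem' := by
    intro c i hi _
    rw [Polynomial.algebraMap_apply, coeff_C, if_neg (by omega)]

/-- The algebra `𝒟(A)` of differential operators on `A = A(m)`. -/
abbrev DA (m : ℕ) : Type u := diffOps K (cusp K m)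

theorem coeff_derivative_X_mul (p : K[X]) (i : ℕ) :
    (derivative (X * p)).coeff i = p.coeff i * (i + 1) := by
  rw [coeff_derivative, coeff_X_mul]

/-- The operator `h = ∂ x : p ↦ (x p)'` on `A(m)`. -/
def hEnd (m : ℕ) : Module.End K (cusp K m) where
  toFun p := ⟨derivative (X * (p : K[X])), fun i hi him => by
    rw [coeff_derivative_X_mul, p.2 i hi him, zero_mul]⟩
  map_add' p q := by ext1; simp [mul_add]
  map_smul' c p := by ext1; simp

theorem hEnd_mem (m : ℕ) : hEnd K m ∈ diffOps K (cusp K m) := by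
  refine ⟨2, fun a b => ?_⟩
  ext p : 2
  simp only [commMul_apply, hEnd, LinearMap.coe_mk, AddHom.coe_mk, AddSubgroupClass.coe_sub,
    MulMemClass.coe_mul, derivative_mul, derivative_X, LinearMap.zero_apply, ZeroMemClass.coe_zero]
  ring

/-- The element `h = ∂ x` of `𝒟(A)`. -/
def hD (m : ℕ) : DA K m := ⟨hEnd K m, hEnd_mem K m⟩

/-- The automorphism `σ` of `D = K[h]`, `σ(h) = h - 1`. -/
def sigma : K[X] ≃+* K[X] := (algEquivAevalXAddC (-1 : K)).toRingEquiv

/-- The automorphism `σ` of `K(h)`, `σ(h) = h - 1`. -/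
def sigmaRat : RatFunc K ≃+* RatFunc K := IsFractionRing.ringEquivOfRingEquiv (sigma K)

/-- The action of `ℤ` on `K[h]` through the powers of `σ`. -/
instance actPoly : MulSemiringAction (Multiplicative ℤ) K[X] :=
  MulSemiringAction.compHom K[X] (zpowersHom (K[X] ≃+* K[X]) (sigma K))

/-- The action of `ℤ` on `K(h)` through the powers of `σ`. -/
instance actRat : MulSemiringAction (Multiplicative ℤ) (RatFunc K) :=
  MulSemiringAction.compHom (RatFunc K) (zpowersHom (RatFunc K ≃+* RatFunc K) (sigmaRat K))

/-- The skew Laurent polynomial ring `A_{1,x} = K[h][x, x⁻¹; σ]`. -/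
abbrev A1x : Type u := SkewMonoidAlgebra K[X] (Multiplicative ℤ)

/-- The skew Laurent polynomial ring `B = K(h)[x, x⁻¹; σ]`, where `x f = σ(f) x`. -/
abbrev B : Type u := SkewMonoidAlgebra (RatFunc K) (Multiplicative ℤ)

variable {K}

theorem smul_def (n : ℤ) (f : K[X]) :
    Multiplicative.ofAdd n • f = (sigma K ^ n) f := rfl

theorem smul_def_rat (n : ℤ) (f : RatFunc K) :
    Multiplicative.ofAdd n • f = (sigmaRat K ^ n) f := rfl

theorem sigma_apply (f : K[X]) : sigma K f = f.comp (X - C 1) := by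
  simp [sigma, comp, aeval_def, sub_eq_add_neg]

theorem sigma_symm_apply (f : K[X]) : (sigma K).symm f = f.comp (X + C 1) := by
  rw [RingEquiv.symm_apply_eq, sigma_apply, comp_assoc]
  simp

theorem smul_eq_comp (n : ℤ) (f : K[X]) :
    Multiplicative.ofAdd n • f = f.comp (X - C (n : K)) := by
  rw [smul_def]
  induction n with
  | zero => simp
  | succ n ih =>
    rw [add_comm, zpow_add, zpow_one, RingAut.mul_apply, ih, sigma_apply, comp_assoc]
    congr 1
    simp only [sub_comp, X_comp, C_comp]
    push_cast
    simp only [C_add]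
    ring
  | pred n ih =>
    rw [sub_eq_neg_add, zpow_add, zpow_neg_one, RingAut.mul_apply, ih]
    change (sigma K).symm _ = _
    rw [sigma_symm_apply, comp_assoc]
    congr 1
    simp only [sub_comp, X_comp, C_comp]
    push_cast
    simp only [C_add, C_neg]
    ring

theorem sigmaRat_algebraMap (f : K[X]) :
    sigmaRat K (algebraMap K[X] (RatFunc K) f) = algebraMap K[X] (RatFunc K) (sigma K f) :=
  IsFractionRing.ringEquivOfRingEquiv_algebraMap _ _

theorem smul_algebraMap (g : Multiplicative ℤ) (f : K[X]) :
    algebraMap K[X] (RatFunc K) (g • f) = g • algebraMap K[X] (RatFunc K) f := by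
  obtain ⟨n, rfl⟩ := Multiplicative.ofAdd.surjective g
  have h : sigmaRat K = IsFractionRing.ringEquivOfRingEquivHom K[X] (RatFunc K) (sigma K) := rfl
  rw [smul_def, smul_def_rat, h, ← map_zpow]
  exact (IsFractionRing.ringEquivOfRingEquiv_algebraMap _ _).symm

variable (K) in
/-- The inclusion `K[h][x, x⁻¹; σ] ⊆ K(h)[x, x⁻¹; σ]`. -/
def toB : A1x K →+* B K :=
  SkewMonoidAlgebra.liftNCRingHom
    (SkewMonoidAlgebra.singleOneRingHom.comp (algebraMap K[X] (RatFunc K)))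
    (SkewMonoidAlgebra.of (RatFunc K) (Multiplicative ℤ)) (by
      intro f g
      simp [SkewMonoidAlgebra.of_apply, SkewMonoidAlgebra.singleOneRingHom, SkewMonoidAlgebra.single_mul_single, smul_algebraMap])


/-! The action of `K[h][x, x⁻¹; σ]` on `K[x, x⁻¹]`. -/

open LaurentPolynomial (T)

variable (K) in
/-- The operator `h = ∂ x` on `K[x, x⁻¹]`: `h * x^n = (n + 1) x^n`. -/
def hL : Module.End K K[T;T⁻¹] :=
  (AddMonoidAlgebra.basis ℤ K).constr K fun n => ((n : K) + 1) • T n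

theorem hL_T (n : ℤ) : hL K (T n) = ((n : K) + 1) • T n := by
  have := (AddMonoidAlgebra.basis ℤ K).constr_basis K (fun n => ((n : K) + 1) • T (R := K) n) n
  rwa [AddMonoidAlgebra.basis_apply] at this

theorem aeval_hL_T (f : K[X]) (n : ℤ) :
    aeval (hL K) f (T n) = f.eval ((n : K) + 1) • T n := by
  induction f using Polynomial.induction_on' with
  | add p q hp hq => simp [hp, hq, add_smul]
  | monomial k c =>
    have : ∀ k : ℕ, (hL K ^ k) (T n) = ((n : K) + 1) ^ k • T n := by
      intro k
      induction k with
      | zero => simp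
      | succ k ih => rw [pow_succ, Module.End.mul_apply, hL_T, map_smul, ih, smul_smul, pow_succ,
          mul_comm]
    rw [aeval_monomial, Module.End.mul_apply, this, Module.algebraMap_end_apply, eval_monomial,
      smul_smul]

theorem laurent_ext {f g : Module.End K K[T;T⁻¹]} (h : ∀ n, f (T n) = g (T n)) : f = g := by
  refine (AddMonoidAlgebra.basis ℤ K).ext fun n => ?_
  rw [AddMonoidAlgebra.basis_apply]
  exact h n

variable (K) in
/-- The multiplication by `x^n` on `K[x, x⁻¹]`. -/
def mulT : Multiplicative ℤ →* Module.End K K[T;T⁻¹] where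
  toFun n := LinearMap.mulLeft K (T n.toAdd)
  map_one' := by
    refine LinearMap.ext fun p => ?_
    simp
  map_mul' a b := by
    refine LinearMap.ext fun p => ?_
    change T (a.toAdd + b.toAdd) * p = T a.toAdd * (T b.toAdd * p)
    rw [LaurentPolynomial.T_add, mul_assoc]

variable (K) in
/-- The action of `K[h][x, x⁻¹; σ]` on `K[x, x⁻¹]` in which `x` acts by multiplication and
`h = ∂ x` by `p ↦ (x p)'`. -/
def rho : A1x K →+* Module.End K K[T;T⁻¹] :=
  SkewMonoidAlgebra.liftNCRingHom (aeval (hL K) : K[X] →ₐ[K] _).toRingHom (mulT K) (by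
    intro f g
    obtain ⟨n, rfl⟩ := Multiplicative.ofAdd.surjective g
    refine laurent_ext fun k => ?_
    rw [smul_eq_comp]
    change aeval (hL K) _ (T n * T k) = T n * aeval (hL K) f (T k)
    rw [← LaurentPolynomial.T_add, aeval_hL_T, aeval_hL_T, mul_smul_comm,
      ← LaurentPolynomial.T_add]
    congr 1
    simp [eval_comp]
    ring_nf)

theorem rho_single (n : ℤ) (f : K[X]) (p : K[T;T⁻¹]) :
    rho K (.single (.ofAdd n) f) p = aeval (hL K) f (T n * p) := by
  have : rho K (.single (.ofAdd n) f) = aeval (hL K) f * mulT K (.ofAdd n) :=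
    SkewMonoidAlgebra.liftNC_single _ _ _ _
  rw [this]; rfl

theorem rho_single_T (n k : ℤ) (f : K[X]) :
    rho K (.single (.ofAdd n) f) (T k) = f.eval ((n + k : K) + 1) • T (n + k) := by
  rw [rho_single, ← LaurentPolynomial.T_add, aeval_hL_T]
  push_cast; rfl

theorem coeff_rho (w : A1x K) (k n : ℤ) :
    (rho K w (T k)).coeff (n + k) = (w.coeff (.ofAdd n)).eval ((n + k : K) + 1) := by
  induction w using SkewMonoidAlgebra.induction_on with
  | zero => simp
  | add f g hf hg =>
    rw [map_add (rho K), LinearMap.add_apply, AddMonoidAlgebra.coeff_add, Finsupp.add_apply, hf,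
      hg, SkewMonoidAlgebra.coeff_add, Finsupp.add_apply, eval_add]
  | single g f =>
    obtain ⟨i, rfl⟩ := Multiplicative.ofAdd.surjective g
    rw [rho_single_T, AddMonoidAlgebra.coeff_smul, Finsupp.smul_apply, LaurentPolynomial.T_apply,
      SkewMonoidAlgebra.coeff_single]
    by_cases h : i = n
    · subst h; simp
    · rw [if_neg (by omega), Finsupp.single_eq_of_ne (by simpa using fun h' => h h'.symm)]
      simp

/-- The inclusion of `A(m)` in `K[x, x⁻¹]`. -/
def jA (m : ℕ) : cusp K m →ₐ[K] K[T;T⁻¹] := toLaurentAlg.comp (cusp K m).val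

theorem jA_injective (m : ℕ) : Function.Injective (jA (K := K) m) :=
  toLaurent_injective.comp Subtype.val_injective

/-- The element `x^k` of `A(m)`, `k ≥ m`. -/
def xA {m k : ℕ} (hk : m ≤ k) : cusp K m :=
  ⟨X ^ k, fun i _ him => by rw [coeff_X_pow, if_neg (by omega)]⟩

theorem jA_xA {m k : ℕ} (hk : m ≤ k) : jA m (xA (K := K) hk) = T k := by
  simp [jA, xA]

theorem cusp_linearMap_ext {m : ℕ} {M : Type*} [AddCommGroup M] [Module K M]
    {f g : cusp K m →ₗ[K] M} (h1 : f 1 = g 1)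
    (h : ∀ k (hk : m ≤ k), f (xA hk) = g (xA hk)) : f = g := by
  ext p
  have key : p = ∑ i ∈ (p : K[X]).support.attach, (p : K[X]).coeff i •
      (if hi : m ≤ (i : ℕ) then xA hi else 1) := by
    ext1
    rw [AddSubmonoidClass.coe_finsetSum]
    conv_lhs => rw [(p : K[X]).as_sum_support, ← Finset.sum_attach]
    refine Finset.sum_congr rfl fun i _ => ?_
    split_ifs with hi
    · simp [xA, ← C_mul_X_pow_eq_monomial, smul_eq_C_mul]
    · have h0 : (i : ℕ) = 0 := by
        by_contra h0
        exact (mem_support_iff.1 i.2) (p.2 i (by omega) (by omega))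
      simp [h0, smul_eq_C_mul]
  rw [key, map_sum, map_sum]
  refine Finset.sum_congr rfl fun i _ => ?_
  rw [map_smul, map_smul]
  split_ifs with hi
  · rw [h]
  · rw [h1]

section CharZero

variable [CharZero K]

theorem eq_zero_of_rho_jA {m : ℕ} {w : A1x K} (h : ∀ a, rho K w (jA m a) = 0) : w = 0 := by
  ext g : 1
  obtain ⟨n, rfl⟩ := Multiplicative.ofAdd.surjective g
  rw [SkewMonoidAlgebra.coeff_zero, Finsupp.zero_apply]
  refine eq_zero_of_infinite_isRoot _ (Set.infinite_of_injective_forall_mem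
    (f := fun k : ℕ => ((n : K) + ((m + k : ℕ) : ℤ)) + 1) ?_ fun k => ?_)
  · intro a b hab
    simpa using hab
  · have := h (xA (Nat.le_add_right m k))
    rw [jA_xA] at this
    rw [Set.mem_ofPred_eq, IsRoot.def, ← coeff_rho, this]
    simp

theorem exists_sub_smul_eq {m : ℕ} (hm : m ≠ 0) (f : K[X]) :
    ∃ g : K[X], g - Multiplicative.ofAdd (m : ℤ) • g = f := by
  let Δ : K[X] →ₗ[K] K[X] := LinearMap.id - (aeval (X - C (m : K)) : K[X] →ₐ[K] K[X]).toLinearMap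
  have hΔ : ∀ g, Δ g = g - Multiplicative.ofAdd (m : ℤ) • g := by
    intro g
    rw [smul_eq_comp]
    simp [Δ, comp, aeval_def]
  suffices h : ∀ d : ℕ, (X ^ d : K[X]) ∈ LinearMap.range Δ by
    have : f ∈ LinearMap.range Δ := by
      rw [f.as_sum_support_C_mul_X_pow]
      exact Submodule.sum_mem _ fun i _ => by
        rw [← smul_eq_C_mul]; exact Submodule.smul_mem _ _ (h i)
    obtain ⟨g, hg⟩ := this
    exact ⟨g, by rw [← hΔ, hg]⟩
  intro d
  induction d using Nat.strong_induction_on with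
  | _ d ih =>
    have h1 : Δ (X ^ (d + 1)) = X ^ (d + 1) - (X + C (-(m : K))) ^ (d + 1) := by
      simp [Δ, sub_eq_add_neg]
    rw [add_pow, Finset.sum_range_succ, Finset.sum_range_succ] at h1
    have h2 : (((d : K) + 1) * m) • (X ^ d : K[X]) = Δ (X ^ (d + 1)) +
        ∑ x ∈ Finset.range d, ((-(m : K)) ^ (d + 1 - x) * ((d + 1).choose x : K)) • X ^ x := by
      rw [h1]
      have : ∀ x ∈ Finset.range d, ((-(m : K)) ^ (d + 1 - x) * ((d + 1).choose x : K)) • X ^ x =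
          X ^ x * C (-(m : K)) ^ (d + 1 - x) * ((d + 1).choose x : K[X]) := by
        intro x _
        rw [smul_eq_C_mul, C_mul, C_pow, C_eq_natCast]; ring
      rw [Finset.sum_congr rfl this, smul_eq_C_mul, Nat.choose_symm_of_eq_add (show d + 1 = d + 1 by rfl)]
      simp
      ring
    have h3 : (((d : K) + 1) * m) • (X ^ d : K[X]) ∈ LinearMap.range Δ := by
      rw [h2]
      refine Submodule.add_mem _ ⟨_, rfl⟩ (Submodule.sum_mem _ fun x hx => ?_)
      exact Submodule.smul_mem _ _ (ih x (Finset.mem_range.1 hx))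
    have h4 : ((d : K) + 1) * m ≠ 0 :=
      mul_ne_zero (by exact_mod_cast Nat.succ_ne_zero d) (by exact_mod_cast hm)
    exact (Submodule.smul_mem_iff _ h4).1 h3

theorem eq_C_of_smul_eq {m : ℕ} (hm : m ≠ 0) {f : K[X]}
    (h : Multiplicative.ofAdd (m : ℤ) • f = f) : ∃ c, f = C c := by
  refine ⟨f.eval 0, ?_⟩
  rw [← sub_eq_zero]
  rw [smul_eq_comp] at h
  have key : ∀ n : ℕ, f.eval (-((n : K) * m)) = f.eval 0 := by
    intro n
    induction n with
    | zero => simp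
    | succ n ih =>
      rw [← ih]
      conv_rhs => rw [← h]
      rw [eval_comp]
      congr 1
      simp
      ring
  refine eq_zero_of_infinite_isRoot _ (Set.infinite_of_injective_forall_mem
    (f := fun n : ℕ => -((n : K) * m)) ?_ fun k => ?_)
  · intro a b hab
    simpa [hm] using hab
  · simp [key]

end CharZero

variable (K) in
/-- The element `x^k` of `K[h][x, x⁻¹; σ]`. -/
def xW (k : ℤ) : A1x K := .single (.ofAdd k) 1

theorem rho_xW (k : ℤ) (q : K[T;T⁻¹]) : rho K (xW K k) q = T k * q := by
  rw [xW, rho_single, map_one]; rfl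

theorem exists_rho_eq_mul (Q : K[T;T⁻¹]) : ∃ w : A1x K, ∀ q, rho K w q = q * Q := by
  induction Q using LaurentPolynomial.induction_on' with
  | add P Q hP hQ =>
    obtain ⟨w, hw⟩ := hP
    obtain ⟨v, hv⟩ := hQ
    exact ⟨w + v, fun q => by rw [map_add (rho K), LinearMap.add_apply, hw, hv, mul_add]⟩
  | C_mul_T n c =>
    refine ⟨.single (.ofAdd n) (C c), fun q => ?_⟩
    rw [rho_single, aeval_C, Module.algebraMap_end_apply, LaurentPolynomial.smul_eq_C_mul]
    ring

section CharZero

variable [CharZero K]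

theorem exists_comm_eq {N : ℕ} (hN : N ≠ 0) (w : A1x K) :
    ∃ v : A1x K, v * xW K N - xW K N * v = w := by
  induction w using SkewMonoidAlgebra.induction_on with
  | zero => exact ⟨0, by simp⟩
  | add f g hf hg =>
    obtain ⟨v, hv⟩ := hf
    obtain ⟨v', hv'⟩ := hg
    exact ⟨v + v', by rw [← hv, ← hv', add_mul, mul_add]; abel⟩
  | single i f =>
    obtain ⟨g, hg⟩ := exists_sub_smul_eq hN f
    refine ⟨.single (i * (.ofAdd (N : ℤ))⁻¹) g, ?_⟩
    rw [xW, SkewMonoidAlgebra.single_mul_single, SkewMonoidAlgebra.single_mul_single]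
    rw [inv_mul_cancel_right, mul_comm i, mul_inv_cancel_left, smul_one, mul_one, one_mul, ← hg,
      sub_eq_add_neg, sub_eq_add_neg, SkewMonoidAlgebra.single_add, SkewMonoidAlgebra.single_neg]

theorem comm_xW {N : ℕ} (hN : N ≠ 0) {u : A1x K} (h : u * xW K N = xW K N * u) (k : ℤ) :
    u * xW K k = xW K k * u := by
  have key : ∀ g, ∃ c, u.coeff g = C c := by
    intro g
    refine eq_C_of_smul_eq hN ?_
    have := congrArg (fun v => v.coeff (g * .ofAdd (N : ℤ))) h
    simp only [xW, SkewMonoidAlgebra.coeff_mul_single, SkewMonoidAlgebra.coeff_single_mul] at this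
    rw [mul_inv_cancel_right, mul_comm g, inv_mul_cancel_left, smul_one, mul_one, one_mul] at this
    exact this.symm
  ext g : 1
  simp only [xW, SkewMonoidAlgebra.coeff_mul_single, SkewMonoidAlgebra.coeff_single_mul]
  rw [smul_one, mul_one, one_mul, mul_comm g]
  obtain ⟨c, hc⟩ := key ((.ofAdd k)⁻¹ * g)
  rw [hc, smul_eq_comp, C_comp]

theorem exists_rho_eq {m : ℕ} {δ : Module.End K (cusp K m)} (hδ : δ ∈ diffOps K (cusp K m)) :
    ∃ w : A1x K, ∀ p, rho K w (jA m p) = jA m (δ p) := by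
  obtain ⟨n, hδ⟩ := hδ
  induction n generalizing δ with
  | zero => exact ⟨0, fun p => by rw [show δ = 0 from hδ]; simp⟩
  | succ n ih =>
    choose w hw using fun a => ih (hδ a)
    have hN : m + 1 ≠ 0 := Nat.succ_ne_zero m
    have hmN : m ≤ m + 1 := Nat.le_succ m
    obtain ⟨v, hv⟩ := exists_comm_eq hN (w (xA hmN))
    let D : cusp K m →ₗ[K] K[T;T⁻¹] :=
      (jA m).toLinearMap ∘ₗ δ - (rho K v) ∘ₗ (jA m).toLinearMap
    have hD : ∀ p, D p = jA m (δ p) - rho K v (jA m p) := fun p => rfl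
    have hu : ∀ k (hk : m ≤ k), ∀ p,
        rho K (w (xA hk) - (v * xW K k - xW K k * v)) (jA m p) = D (xA hk * p) - T k * D p := by
      intro k hk p
      rw [map_sub, map_sub, map_mul, map_mul, LinearMap.sub_apply, LinearMap.sub_apply,
        Module.End.mul_apply, Module.End.mul_apply, rho_xW, rho_xW, hw, commMul_apply, hD, hD,
        map_sub, map_mul (jA m), map_mul (jA m), jA_xA]
      ring
    have hDN : ∀ p, D (xA hmN * p) = T (m + 1 : ℕ) * D p := by
      intro p
      have := hu _ hmN p
      rw [← hv, sub_self, map_zero, LinearMap.zero_apply] at this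
      exact (sub_eq_zero.1 this.symm)
    have hDN' : ∀ r : ℕ, ∀ p, D (xA hmN ^ r * p) = T (m + 1 : ℕ) ^ r * D p := by
      intro r
      induction r with
      | zero => simp
      | succ r ihr => intro p; rw [pow_succ', mul_assoc, hDN, ihr, pow_succ', mul_assoc]
    have hDk : ∀ k (hk : m ≤ k), D (xA hk) = T k * D 1 := by
      intro k hk
      have huk := hu k hk
      set u := w (xA hk) - (v * xW K k - xW K k * v)
      have hcomm : u * xW K (m + 1 : ℕ) = xW K (m + 1 : ℕ) * u := by
        rw [← sub_eq_zero]
        refine eq_zero_of_rho_jA (m := m) fun p => ?_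
        rw [map_sub, map_mul, map_mul, LinearMap.sub_apply, Module.End.mul_apply,
          Module.End.mul_apply, rho_xW, rho_xW, ← jA_xA hmN, ← map_mul, huk, huk, jA_xA,
          mul_left_comm, hDN, hDN]
        ring
      have hcomm' : ∀ q, rho K u (T k * q) = T k * rho K u q := by
        intro q
        have := congrArg (fun v => rho K v q) (comm_xW hN hcomm k)
        simpa only [map_mul, Module.End.mul_apply, rho_xW] using this
      have hcomm'' : ∀ (r : ℕ) q, rho K u (T k ^ r * q) = T k ^ r * rho K u q := by
        intro r
        induction r with
        | zero => simp
        | succ r ihr => intro q; rw [pow_succ', mul_assoc, hcomm', ihr, mul_assoc]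
      have hr : ∀ r : ℕ, T k * D (xA hk ^ r * 1) =
          T k ^ (r + 1) * D 1 + (r : K) • (T k ^ r * rho K u 1) := by
        intro r
        induction r with
        | zero => simp
        | succ r ihr =>
          have h1 := huk (xA hk ^ r * 1)
          rw [map_mul, map_pow, jA_xA, map_one, hcomm''] at h1
          rw [pow_succ', mul_assoc, ← sub_add_cancel (D _) (T k * D (xA hk ^ r * 1)), ← h1, ihr]
          simp only [LaurentPolynomial.smul_eq_C_mul, Nat.cast_succ, map_add, map_one]
          ring
      have hpow : (xA hk : cusp K m) ^ (m + 1) = xA hmN ^ k := by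
        ext1
        simp [xA, ← pow_mul, mul_comm]
      have hT : (T (m + 1 : ℕ) : K[T;T⁻¹]) ^ k = T k ^ (m + 1) := by
        rw [LaurentPolynomial.T_pow, LaurentPolynomial.T_pow, mul_comm]
      have h2 := hr (m + 1)
      rw [hpow, hDN', hT, ← mul_assoc, ← pow_succ', left_eq_add, smul_eq_zero] at h2
      have h3 : rho K u 1 = 0 := by
        rcases h2 with h2 | h2
        · exact absurd (Nat.cast_eq_zero.1 h2) hN
        · exact (((LaurentPolynomial.isUnit_T (k : ℤ)).pow (m + 1)).mul_right_eq_zero).1 h2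
      have h4 := huk 1
      rw [map_one, h3, mul_one] at h4
      exact sub_eq_zero.1 h4.symm
    obtain ⟨v', hv'⟩ := exists_rho_eq_mul (D 1)
    have hext : D = (rho K v') ∘ₗ (jA m).toLinearMap := by
      refine cusp_linearMap_ext ?_ fun k hk => ?_
      · change D 1 = rho K v' (jA m 1)
        rw [hv', map_one (jA m), one_mul]
      · change D (xA hk) = rho K v' (jA m (xA hk))
        rw [hv', hDk, jA_xA]
    refine ⟨v + v', fun p => ?_⟩
    have : rho K v' (jA m p) = D p := by rw [hext]; rfl
    rw [map_add (rho K), LinearMap.add_apply, this, hD]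
    ring

variable (K) in
/-- Every differential operator on `A(m)` is induced by a unique element of
`A_{1,x} = K[h][x, x⁻¹; σ]`, where `A_{1,x}` acts on `K[x, x⁻¹] ⊇ A(m)`. -/
theorem existsUnique_rho (m : ℕ) (δ : DA K m) :
    ∃! w : A1x K, ∀ p, rho K w (jA m p) = jA m ((δ : Module.End K (cusp K m)) p) := by
  obtain ⟨w, hw⟩ := exists_rho_eq δ.2
  refine ⟨w, hw, fun v hv => ?_⟩
  rw [← sub_eq_zero]
  exact eq_zero_of_rho_jA (m := m) fun p => by rw [map_sub, LinearMap.sub_apply, hw, hv, sub_self]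

variable (K) in
/-- The embedding `𝒟(A) ⊆ A_{1,x} = K[h][x, x⁻¹; σ]`: it sends `δ` to the unique element of
`A_{1,x}` whose action on `K[x, x⁻¹]` restricts to `δ` on `A`. -/
def toA1x (m : ℕ) : DA K m →+* A1x K where
  toFun δ := (existsUnique_rho K m δ).choose
  map_one' := ((existsUnique_rho K m 1).choose_spec.2 _ fun p => by simp).symm
  map_zero' := ((existsUnique_rho K m 0).choose_spec.2 _ fun p => by simp).symm
  map_mul' a b := ((existsUnique_rho K m (a * b)).choose_spec.2 _ fun p => by
    rw [map_mul, Module.End.mul_apply, (existsUnique_rho K m b).choose_spec.1,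
      (existsUnique_rho K m a).choose_spec.1]; rfl).symm
  map_add' a b := ((existsUnique_rho K m (a + b)).choose_spec.2 _ fun p => by
    rw [map_add (rho K), LinearMap.add_apply, (existsUnique_rho K m b).choose_spec.1,
      (existsUnique_rho K m a).choose_spec.1, ← map_add]; rfl).symm

theorem rho_toA1x (m : ℕ) (δ : DA K m) (p : cusp K m) :
    rho K (toA1x K m δ) (jA m p) = jA m ((δ : Module.End K (cusp K m)) p) :=
  (existsUnique_rho K m δ).choose_spec.1 p

variable (K) in
/-- The embedding `𝒟(A) ⊆ B = K(h)[x, x⁻¹; σ]`. -/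
def iota (m : ℕ) : DA K m →+* B K := (toB K).comp (toA1x K m)

end CharZero

/-! Right divisibility and similarity. -/

section Similar

variable {R : Type*} [Semiring R]

/-- `a` is a right divisor of `b`, equivalently `b` is a left multiple of `a`. -/
def RightDvd (a b : R) : Prop := ∃ u, b = u * a

/-- `g` is a greatest common right divisor of `a` and `b`. -/
def IsGCRD (g a b : R) : Prop :=
  RightDvd g a ∧ RightDvd g b ∧ ∀ e, RightDvd e a → RightDvd e b → RightDvd e g

/-- `l` is a least common left multiple of `a` and `b`. -/
def IsLCLM (l a b : R) : Prop :=
  RightDvd a l ∧ RightDvd b l ∧ ∀ e, RightDvd a e → RightDvd b e → RightDvd l e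

/-- `b` and `c` are similar: there is `d` such that `1` is the greatest common right divisor of
`c` and `d`, and `b d` is a least common left multiple of `c` and `d`. -/
def AreSimilar (b c : R) : Prop := ∃ d, IsGCRD 1 c d ∧ IsLCLM (b * d) c d

end Similar

/-! The order on the `σ`-orbits of maximal ideals and `𝔸`-normal elements. -/

/-- The ideals `p` and `q` of `D = K[h]` lie in the same `σ`-orbit. -/
def SameOrbit (p q : Ideal K[X]) : Prop := ∃ i : ℤ, q = p.map (sigma K ^ i)

/-- The strict order on a `σ`-orbit: `σ^i(p) < σ^j(p)` iff `i < j`. -/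
def OrbitLT (p q : Ideal K[X]) : Prop := ∃ i : ℤ, 0 < i ∧ q = p.map (sigma K ^ i)

/-- The relation `α < β` on `D = K[h]`: one has `p < q` for all maximal ideals `p`, `q` in the
same `σ`-orbit with `α ∈ p` and `β ∈ q`. -/
def PolyLT (α β : K[X]) : Prop :=
  ∀ p q : Ideal K[X], p.IsMaximal → q.IsMaximal → SameOrbit p q → α ∈ p → β ∈ q → OrbitLT p q

/-- The inclusion `D = K[h] ⊆ B`. -/
def ofD (f : K[X]) : B K := .single 1 (algebraMap K[X] (RatFunc K) f)

variable (K) in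
/-- The element `δ_{-1} = h (h - m) x⁻¹` of `𝒟(A) ⊆ B`. -/
def deltaNeg (m : ℕ) : B K :=
  .single (.ofAdd (-1)) (algebraMap K[X] (RatFunc K) (X * (X - C (m : K))))

variable (K) in
/-- The defining element `a = h (h - 1) (h - m)` of the generalized Weyl algebra
`𝔸 = D[δ_1, δ_{-1}; σ, a]`. -/
def definingElt (m : ℕ) : K[X] := X * (X - C 1) * (X - C (m : K))

/-- `b` is `𝔸`-normal: `b = δ_{-1}^n β_n + ⋯ + δ_{-1} β_1 + β_0` with `n ≥ 1`, `β_i ∈ D`,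
`β_n ≠ 0`, `β_0 ≠ 0`, `β_0 < β_n` and `β_0 < a`. -/
def IsNormalElt (m : ℕ) (b : B K) : Prop :=
  ∃ n : ℕ, 1 ≤ n ∧ ∃ β : ℕ → K[X], β n ≠ 0 ∧ β 0 ≠ 0 ∧
    b = ∑ i ∈ Finset.range (n + 1), deltaNeg K m ^ i * ofD (β i) ∧
    PolyLT (β 0) (β n) ∧ PolyLT (β 0) (definingElt K m)

variable (K) in
/-- A `𝒟(A)`-module is `D`-torsion free, `D = K[h]`, if no nonzero element of `D` kills a nonzero
element of it. -/
def IsDTorsionFree (m : ℕ) (M : Type*) [AddCommGroup M] [Module (DA K m) M] : Prop :=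
  ∀ f : K[X], f ≠ 0 → ∀ v : M, aeval (hD K m) f • v = 0 → v = 0

/-- The left ideal `𝒟(A) ∩ B b` of `𝒟(A)`. -/
def leftIdeal [CharZero K] (m : ℕ) (b : B K) : Ideal (DA K m) :=
  Ideal.comap (iota K m) (Ideal.span {b})

/-- The `𝒟(A)`-module `M_b = 𝒟(A) / (𝒟(A) ∩ B b)`. -/
abbrev Mb [CharZero K] (m : ℕ) (b : B K) : Type u := DA K m ⧸ leftIdeal m b

end CuspDiff

end

noncomputable section

/-! ### Skew group algebras of ordered groups -/

namespace SkewMonoidAlgebra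

variable {k G : Type*} [Ring k] [LinearOrder G]

/-! Inverting the nonzero elements of `K[h]` in `𝒟(A)` produces `B`: each element of `B` lands in
`𝒟(A)` after left multiplication by a nonzero polynomial in `h` (`exists_ofD_mul_eq_iota`). The ring
`B` is a domain with Euclidean division by the width of the support, so its left ideals are
principal (`exists_eq_span_singleton`) and `Bb` is maximal for irreducible `b`
(`span_singleton_sup_eq_top`).

A simple torsion-free module `M` embeds in its localization, and the annihilator there of a nonzero
vector of `M` is some `Bb` with `b` irreducible (`exists_annB_eq`); hence `M ≅ M_b`. Conversely, for
irreducible `b`, a left ideal of `𝒟(A)` strictly larger than `𝒟(A) ∩ Bb` contains a nonzero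
polynomial in `h`. Normality of `b` forces such an ideal to be everything: otherwise the extreme
shifts of a prime factor of its intersection with `K[h]` would contradict `β₀ < β_{-n}` or `β₀ < a`
(`one_mem_of_isNormal`). This gives simplicity.

An irreducible `b` becomes normal after multiplication by units on both sides, chosen so that `β₀`
is shifted far down its orbits while the top coefficient stays fixed (`exists_isNormalElt`). If both
quotients are simple, such a change does not affect the isomorphism class (`Mb_nonempty_equiv`).
Finally, an isomorphism `M_b ≅ M_{b'}` is right multiplication by some `d` with `{c | cd ∈ Bb'} =
Bb`, which is similarity (`nonempty_equiv_iff_areSimilar`). -/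

theorem exists_coeff_top {f : SkewMonoidAlgebra k G} (hf : f ≠ 0) :
    ∃ a, f.coeff a ≠ 0 ∧ ∀ c, a < c → f.coeff c = 0 := by
  have hne : f.coeff.support.Nonempty := by
    rw [Finsupp.support_nonempty_iff]
    exact fun h => hf (coeff_eq_zero.1 h)
  refine ⟨f.coeff.support.max' hne, Finsupp.mem_support_iff.1 (Finset.max'_mem _ _),
    fun c hc => ?_⟩
  by_contra h
  exact absurd (Finset.le_max' _ c (Finsupp.mem_support_iff.2 h)) (not_le.2 hc)

variable [CommGroup G] [IsOrderedMonoid G] [MulSemiringAction G k]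

theorem coeff_mul_top {f g : SkewMonoidAlgebra k G} {a b : G}
    (hf : ∀ c, a < c → f.coeff c = 0) (hg : ∀ c, b < c → g.coeff c = 0) :
    (f * g).coeff (a * b) = f.coeff a * a • g.coeff b := by
  rw [coeff_mul_left, sum_def, Finsupp.sum, Finset.sum_eq_single a]
  · simp
  · intro c _ hca
    rcases lt_or_gt_of_ne hca with h | h
    · rw [hg _ (by rw [lt_inv_mul_iff_mul_lt]; exact mul_lt_mul_left h b), smul_zero, mul_zero]
    · rw [hf c h, zero_mul]
  · intro h
    rw [Finsupp.notMem_support_iff.1 h, zero_mul]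

/-- The product of the leading coefficients, one of them twisted by the action, is the leading
coefficient of the product. The twist is injective. -/
theorem noZeroDivisors_of_orderedGroup [NoZeroDivisors k] :
    NoZeroDivisors (SkewMonoidAlgebra k G) where
  eq_zero_or_eq_zero_of_mul_eq_zero := by
    intro f g h
    by_contra! hne
    obtain ⟨a, ha, ha'⟩ := exists_coeff_top hne.1
    obtain ⟨b, hb, hb'⟩ := exists_coeff_top hne.2
    have := coeff_mul_top ha' hb'
    rw [h, coeff_zero, Finsupp.zero_apply, eq_comm, mul_eq_zero] at this
    exact this.elim ha (fun h => hb ((smul_eq_zero_iff_eq a).1 h))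

end SkewMonoidAlgebra

namespace CuspDiff

universe u

variable {K : Type u} [Field K]

/-! ### The ring `B` -/

instance instNoZeroDivisorsB : NoZeroDivisors (B K) :=
  SkewMonoidAlgebra.noZeroDivisors_of_orderedGroup

theorem isUnit_of_mul_eq_one_B {a b : B K} (h : a * b = 1) : IsUnit a ∧ IsUnit b := by
  have hb : b ≠ 0 := by rintro rfl; simp at h
  have h' : b * a = 1 := by
    have : (b * a - 1) * b = 0 := by rw [sub_mul, mul_assoc, h, mul_one, one_mul, sub_self]
    exact sub_eq_zero.1 ((mul_eq_zero.1 this).resolve_right hb)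
  exact ⟨⟨⟨a, b, h, h'⟩, rfl⟩, ⟨⟨b, a, h', h⟩, rfl⟩⟩

/-- The monomial `f x^n` of `B`. -/
abbrev monoB (n : ℤ) (f : RatFunc K) : B K := SkewMonoidAlgebra.single (Multiplicative.ofAdd n) f

/-- The action of `σ^n` on `K(h)`. -/
abbrev sg (n : ℤ) (f : RatFunc K) : RatFunc K := Multiplicative.ofAdd n • f

theorem sg_sg (n k : ℤ) (f : RatFunc K) : sg n (sg k f) = sg (n + k) f := by
  rw [sg, sg, sg, ofAdd_add, mul_smul]

theorem sg_zero (f : RatFunc K) : sg 0 f = f := by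
  rw [sg, ofAdd_zero, one_smul]

theorem sg_map_zero (n : ℤ) : sg n (0 : RatFunc K) = 0 := smul_zero _

theorem sg_ne_zero {n : ℤ} {f : RatFunc K} (hf : f ≠ 0) : sg n f ≠ 0 :=
  (smul_ne_zero_iff_ne _).2 hf

theorem monoB_mul_monoB (n k : ℤ) (f g : RatFunc K) :
    monoB n f * monoB k g = monoB (n + k) (f * sg n g) := by
  rw [monoB, monoB, monoB, SkewMonoidAlgebra.single_mul_single, ofAdd_add]

theorem monoB_zero_one : monoB 0 (1 : RatFunc K) = 1 := rfl

theorem isUnit_monoB (n : ℤ) {f : RatFunc K} (hf : f ≠ 0) : IsUnit (monoB n f) := by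
  refine (isUnit_of_mul_eq_one_B (b := monoB (-n) (sg (-n) f⁻¹)) ?_).1
  rw [monoB_mul_monoB, sg_sg, add_neg_cancel, sg_zero, mul_inv_cancel₀ hf, monoB_zero_one]

theorem coeff_monoB_mul (n : ℤ) (f : RatFunc K) (b : B K) (k : ℤ) :
    (monoB n f * b).coeff (.ofAdd k) = f * sg n (b.coeff (.ofAdd (k - n))) := by
  rw [SkewMonoidAlgebra.coeff_single_mul, ← ofAdd_neg, ← ofAdd_add, neg_add_eq_sub]

theorem eq_zero_of_coeff {b : B K} (h : ∀ n : ℤ, b.coeff (.ofAdd n) = 0) : b = 0 := by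
  ext g
  obtain ⟨n, rfl⟩ := Multiplicative.ofAdd.surjective g
  rw [h, SkewMonoidAlgebra.coeff_zero, Finsupp.zero_apply]

/-! ### Euclidean division in `B` by the width of the support -/

/-- All exponents of `b` lie in the interval `[l, l + w)`. -/
def SuppIn (b : B K) (l : ℤ) (w : ℕ) : Prop :=
  ∀ n : ℤ, b.coeff (.ofAdd n) ≠ 0 → l ≤ n ∧ n < l + w

theorem SuppIn.eq_zero {b : B K} {l : ℤ} (h : SuppIn b l 0) : b = 0 := by
  refine eq_zero_of_coeff fun n => ?_
  by_contra hn
  have := h n hn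
  omega

theorem exists_suppIn (b : B K) : ∃ l w, SuppIn b l w := by
  obtain ⟨N, hN⟩ := (b.coeff.support.image fun g => (Multiplicative.toAdd g).natAbs).exists_le
  refine ⟨-N, 2 * N + 1, fun n hn => ?_⟩
  have := hN _ (Finset.mem_image_of_mem _ (Finsupp.mem_support_iff.2 hn))
  rw [toAdd_ofAdd] at this
  omega

/-- One division step: a monomial multiple of `b` cancels the top coefficient of `c`. Since `b` is
no wider than `c`, nothing is added below the support interval of `c`. -/
theorem exists_suppIn_sub {b c : B K} {l k : ℤ} {v w : ℕ} (hb : SuppIn b l (w + 1))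
    (hbw : b.coeff (.ofAdd (l + w)) ≠ 0) (hc : SuppIn c k (v + 1)) (hwv : w ≤ v) :
    ∃ q, SuppIn (c - q * b) k v := by
  refine ⟨monoB (k + v - (l + w))
    (c.coeff (.ofAdd (k + v)) * (sg (k + v - (l + w)) (b.coeff (.ofAdd (l + w))))⁻¹),
    fun n hn => ?_⟩
  rw [SkewMonoidAlgebra.coeff_sub, Finsupp.sub_apply, coeff_monoB_mul] at hn
  by_cases hnk : n = k + v
  · subst hnk
    rw [sub_sub_cancel, inv_mul_cancel_right₀ (sg_ne_zero hbw), sub_self] at hn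
    exact absurd rfl hn
  by_cases h0 : c.coeff (.ofAdd n) = 0
  · rw [h0, zero_sub, neg_ne_zero] at hn
    have : b.coeff (.ofAdd (n - (k + v - (l + w)))) ≠ 0 := fun h => by
      rw [h, sg_map_zero, mul_zero] at hn
      exact hn rfl
    have := hb _ this
    push_cast at this
    omega
  · have := hc _ h0
    push_cast at this
    omega

theorem exists_eq_span_singleton (I : Ideal (B K)) : ∃ b, I = Ideal.span {b} := by
  classical
  by_cases hI : I = ⊥
  · exact ⟨0, by rw [hI, Ideal.span_singleton_zero]⟩
  obtain ⟨b₀, hb₀, hb₀'⟩ := Submodule.exists_mem_ne_zero_of_ne_bot hI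
  have hW : ∃ w : ℕ, ∃ b ∈ I, b ≠ 0 ∧ ∃ l, SuppIn b l w := by
    obtain ⟨l, w, h⟩ := exists_suppIn b₀
    exact ⟨w, b₀, hb₀, hb₀', l, h⟩
  obtain ⟨b, hbI, hb0, l, hb⟩ := Nat.find_spec hW
  have hmin := fun w (hw : w < Nat.find hW) => Nat.find_min hW hw
  generalize Nat.find hW = w at hb hmin
  rcases w with _ | w
  · exact absurd hb.eq_zero hb0
  have hbw : b.coeff (.ofAdd (l + w)) ≠ 0 := by
    intro h
    refine hmin w (Nat.lt_succ_self w) ⟨b, hbI, hb0, l, fun n hn => ?_⟩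
    have h1 := hb n hn
    have h2 : n ≠ l + w := by rintro rfl; exact hn h
    push_cast at h1
    omega
  refine ⟨b, le_antisymm (fun c hc => ?_) (by rwa [Ideal.span_singleton_le_iff_mem])⟩
  obtain ⟨k, v, hcv⟩ := exists_suppIn c
  induction v generalizing c with
  | zero => rw [hcv.eq_zero]; exact zero_mem _
  | succ v ih =>
    by_cases hwv : w ≤ v
    · obtain ⟨q, hq⟩ := exists_suppIn_sub hb hbw hcv hwv
      have h1 := ih (c - q * b) (sub_mem hc (I.mul_mem_left q hbI)) hq
      have h2 : q * b ∈ Ideal.span {b} :=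
        Ideal.mul_mem_left _ q (Ideal.mem_span_singleton_self b)
      simpa using add_mem h1 h2
    · have : c = 0 := by
        by_contra h0
        exact hmin (v + 1) (by omega) ⟨c, hc, h0, k, hcv⟩
      rw [this]; exact zero_mem _

theorem span_singleton_sup_eq_top {b c : B K} (hb : Irreducible b) (hc : c ∉ Ideal.span {b}) :
    ∃ p q : B K, p * c + q * b = 1 := by
  obtain ⟨d, hd⟩ := exists_eq_span_singleton (Ideal.span {c, b})
  have hbd : b ∈ Ideal.span {d} := by rw [← hd]; exact Ideal.subset_span (by simp)
  have hcd : c ∈ Ideal.span {d} := by rw [← hd]; exact Ideal.subset_span (by simp)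
  obtain ⟨u, hu⟩ := Ideal.mem_span_singleton'.1 hbd
  have h1 : (1 : B K) ∈ Ideal.span {c, b} := by
    -- Here `b = u d`, where `d` generates the sum of the two left ideals. If `u` is a unit then `c
    -- ∈ Bd = Bb`, which is excluded; so `d` is a unit.
    rcases hb.isUnit_or_isUnit hu.symm with h | h
    · obtain ⟨v, hv⟩ := h.exists_left_inv
      refine absurd ?_ hc
      obtain ⟨t, ht⟩ := Ideal.mem_span_singleton'.1 hcd
      refine Ideal.mem_span_singleton'.2 ⟨t * v, ?_⟩
      rw [← ht, ← hu, mul_assoc, ← mul_assoc v, hv, one_mul]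
    · obtain ⟨v, hv⟩ := h.exists_left_inv
      rw [hd]
      exact Ideal.mem_span_singleton'.2 ⟨v, hv⟩
  obtain ⟨p, q, h⟩ := Ideal.mem_span_pair.1 h1
  exact ⟨p, q, h⟩

theorem one_notMem_span {b : B K} (hb : ¬ IsUnit b) : (1 : B K) ∉ Ideal.span {b} := by
  intro h
  obtain ⟨u, hu⟩ := Ideal.mem_span_singleton'.1 h
  exact hb (isUnit_of_mul_eq_one_B hu).2

/-! ### The embedding of `𝒟(A)` in `B` -/

open LaurentPolynomial (T)

theorem toB_single (n : ℤ) (f : K[X]) :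
    toB K (.single (.ofAdd n) f) = monoB n (algebraMap K[X] (RatFunc K) f) := by
  have : toB K (.single (.ofAdd n) f) = _ * _ := SkewMonoidAlgebra.liftNC_single _ _ _ _
  rw [this]
  simp [SkewMonoidAlgebra.of_apply, SkewMonoidAlgebra.singleOneRingHom,
    SkewMonoidAlgebra.single_mul_single]

theorem coeff_toB (w : A1x K) (n : ℤ) :
    (toB K w).coeff (.ofAdd n) = algebraMap K[X] (RatFunc K) (w.coeff (.ofAdd n)) := by
  induction w using SkewMonoidAlgebra.induction_on with
  | zero => simp
  | add f g hf hg =>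
    rw [map_add, SkewMonoidAlgebra.coeff_add, Finsupp.add_apply, hf, hg,
      SkewMonoidAlgebra.coeff_add, Finsupp.add_apply, map_add]
  | single g f =>
    obtain ⟨i, rfl⟩ := Multiplicative.ofAdd.surjective g
    rw [toB_single, SkewMonoidAlgebra.coeff_single, SkewMonoidAlgebra.coeff_single]
    by_cases h : i = n
    · subst h; simp
    · rw [Finsupp.single_eq_of_ne (by simpa using fun h' => h h'.symm),
        Finsupp.single_eq_of_ne (by simpa using fun h' => h h'.symm), map_zero]

theorem toB_injective : Function.Injective (toB K) := by
  intro v w h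
  ext g : 1
  obtain ⟨n, rfl⟩ := Multiplicative.ofAdd.surjective g
  refine FaithfulSMul.algebraMap_injective K[X] (RatFunc K) ?_
  rw [← coeff_toB, ← coeff_toB, h]

theorem ofD_eq (f : K[X]) : ofD f = monoB 0 (algebraMap K[X] (RatFunc K) f) := rfl

theorem ofD_mul (f g : K[X]) : ofD (f * g) = ofD f * ofD g := by
  rw [ofD_eq, ofD_eq, ofD_eq, monoB_mul_monoB, add_zero, sg_zero, map_mul]

theorem isUnit_ofD {f : K[X]} (hf : f ≠ 0) : IsUnit (ofD f) :=
  isUnit_monoB 0 ((map_ne_zero_iff _ (FaithfulSMul.algebraMap_injective K[X] (RatFunc K))).2 hf)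

theorem jA_of_coe_eq {m k : ℕ} {p : cusp K m} {c : K} (h : (p : K[X]) = C c * X ^ k) :
    jA m p = c • T k := by
  change toLaurent (p : K[X]) = _
  rw [h, toLaurent_C_mul_X_pow, LaurentPolynomial.smul_eq_C_mul]

/-- The elements `1` and `x^k` with `k ≥ m` span `A`, so a homogeneous operator is identified by its
values on them. -/
theorem rho_single_intertwine {m : ℕ} (n : ℤ) (f : K[X]) (δ : Module.End K (cusp K m))
    (h1 : jA m (δ 1) = f.eval (n + 1 : K) • T n)
    (hk : ∀ k (hk : m ≤ k), jA m (δ (xA hk)) = f.eval ((n + k : K) + 1) • T (n + k)) (p) :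
    rho K (.single (.ofAdd n) f) (jA m p) = jA m (δ p) := by
  have : (rho K (.single (.ofAdd n) f)).comp (jA m).toLinearMap = (jA m).toLinearMap ∘ₗ δ := by
    refine cusp_linearMap_ext ?_ fun k hk' => ?_
    · change rho K _ (jA m 1) = jA m (δ 1)
      rw [h1, map_one, ← LaurentPolynomial.T_zero, rho_single_T]
      simp
    · change rho K _ (jA m (xA hk')) = jA m (δ (xA hk'))
      rw [hk, jA_xA, rho_single_T]
      simp
  exact LinearMap.congr_fun this p

variable (K) in
/-- The operator `δ₁ = (h - 2) x`, which is `p ↦ x² p'`, on `A(m)`. -/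
def deltaPosEnd (m : ℕ) : Module.End K (cusp K m) where
  toFun p := ⟨X ^ 2 * derivative (p : K[X]), fun i hi him => by
    rw [coeff_X_pow_mul']
    split_ifs with h
    · rw [coeff_derivative]
      rcases Nat.lt_or_ge (i - 2 + 1) m with h' | h'
      · rw [p.2 _ (by omega) h', zero_mul]
      · omega
    · rfl⟩
  map_add' p q := by ext1; simp [mul_add]
  map_smul' c p := by ext1; simp

theorem deltaPosEnd_mem (m : ℕ) : deltaPosEnd K m ∈ diffOps K (cusp K m) := by
  refine ⟨2, fun a b => ?_⟩
  ext p : 2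
  simp only [commMul_apply, deltaPosEnd, LinearMap.coe_mk, AddHom.coe_mk,
    AddSubgroupClass.coe_sub, MulMemClass.coe_mul, derivative_mul, LinearMap.zero_apply,
    ZeroMemClass.coe_zero]
  ring

theorem rho_aeval_hEnd (m : ℕ) (f : K[X]) (p : cusp K m) :
    rho K (.single 1 f) (jA m p) = jA m ((aeval (hD K m) f : DA K m).1 p) := by
  have hX : ∀ p : cusp K m, hL K (jA m p) = jA m (hEnd K m p) := by
    intro p
    have := rho_single_intertwine (m := m) 0 X (hEnd K m) ?_ ?_ p
    · rw [← this, rho_single, aeval_X, LaurentPolynomial.T_zero, one_mul]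
    · simp [jA, hEnd]
    · intro k hk
      rw [jA_of_coe_eq (c := (k : K) + 1) (k := k)]
      · simp
      · simp only [hEnd, xA, LinearMap.coe_mk, AddHom.coe_mk, ← pow_succ', derivative_X_pow]
        simp
  have hpow : ∀ (n : ℕ) (p : cusp K m), (hL K ^ n) (jA m p) = jA m ((hEnd K m ^ n) p) := by
    intro n
    induction n with
    | zero => intro p; simp
    | succ n ih =>
      intro p
      rw [pow_succ, Module.End.mul_apply, hX, ih, pow_succ, Module.End.mul_apply]
  have hcoe : ((aeval (hD K m) f : DA K m) : Module.End K (cusp K m)) = aeval (hEnd K m) f :=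
    (aeval_algHom_apply (diffOps K (cusp K m)).val (hD K m) f).symm
  rw [← ofAdd_zero, rho_single, LaurentPolynomial.T_zero, one_mul, hcoe]
  induction f using Polynomial.induction_on' with
  | add f g hf hg =>
    simp only [map_add, LinearMap.add_apply]
    rw [hf, hg]
    · exact (aeval_algHom_apply (diffOps K (cusp K m)).val (hD K m) g).symm
    · exact (aeval_algHom_apply (diffOps K (cusp K m)).val (hD K m) f).symm
  | monomial n c =>
    rw [aeval_monomial, aeval_monomial, Module.End.mul_apply, hpow, Module.algebraMap_end_apply,
      Module.End.mul_apply, Module.algebraMap_end_apply, map_smul]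

section CharZero

variable [CharZero K]

/-- The embedding is defined by choice; uniqueness allows it to be computed from any explicit
candidate `w`. -/
theorem iota_eq_toB {m : ℕ} {δ : DA K m} {w : A1x K}
    (h : ∀ p, rho K w (jA m p) = jA m ((δ : Module.End K (cusp K m)) p)) :
    iota K m δ = toB K w :=
  congrArg (toB K) ((existsUnique_rho K m δ).unique (rho_toA1x m δ) h)

theorem iota_injective (m : ℕ) : Function.Injective (iota K m) := by
  refine toB_injective.comp fun δ ε h => ?_
  apply Subtype.ext
  refine LinearMap.ext fun p => jA_injective m ?_
  rw [← rho_toA1x, ← rho_toA1x, h]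

theorem iota_aeval (m : ℕ) (f : K[X]) : iota K m (aeval (hD K m) f) = ofD f := by
  rw [iota_eq_toB (rho_aeval_hEnd m f), ← ofAdd_zero, toB_single, ofD_eq]

variable (K) in
/-- The operator `δ₋₁ = h (h - m) x⁻¹`, which is `p ↦ x p'' - (m - 1) p'`, on `A(m)`. -/
def deltaNegEnd (m : ℕ) : Module.End K (cusp K m) where
  toFun p := ⟨X * derivative (derivative (p : K[X])) - C ((m : K) - 1) * derivative (p : K[X]),
    fun i hi him => by
      obtain ⟨j, rfl⟩ := Nat.exists_eq_add_of_lt hi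
      rw [coeff_sub, coeff_C_mul, zero_add, coeff_X_mul, coeff_derivative, coeff_derivative]
      -- The coefficient of `x^i` in the image is `(i + 1)(i + 1 - m)` times that of `x^(i+1)` in
      -- `p`. For `i + 1 < m` the latter is zero, and for `i + 1 = m` the factor is.
      rcases Nat.lt_or_ge (j + 1 + 1) m with h' | h'
      · rw [p.2 _ (by omega) h']; ring
      · have : (m : K) = j + 2 := by exact_mod_cast (show m = j + 2 by omega)
        rw [this]; push_cast; ring⟩
  map_add' p q := by ext1; simp; ring
  map_smul' c p := by ext1; simp [smul_eq_C_mul]; ring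

theorem deltaNegEnd_mem (m : ℕ) : deltaNegEnd K m ∈ diffOps K (cusp K m) := by
  refine ⟨3, fun a b c => ?_⟩
  ext p : 2
  simp only [commMul_apply, deltaNegEnd, LinearMap.coe_mk, AddHom.coe_mk,
    AddSubgroupClass.coe_sub, MulMemClass.coe_mul, derivative_mul, derivative_add,
    LinearMap.zero_apply, ZeroMemClass.coe_zero]
  ring

variable (K) in
/-- The element `δ₁` of `𝒟(A)`. -/
def deltaPosD (m : ℕ) : DA K m := ⟨deltaPosEnd K m, deltaPosEnd_mem m⟩

variable (K) in
/-- The element `δ₋₁` of `𝒟(A)`. -/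
def deltaNegD (m : ℕ) : DA K m := ⟨deltaNegEnd K m, deltaNegEnd_mem m⟩

theorem iota_deltaPosD (m : ℕ) :
    iota K m (deltaPosD K m) = monoB 1 (algebraMap K[X] (RatFunc K) (X - C 2)) := by
  rw [← toB_single]
  refine iota_eq_toB (rho_single_intertwine 1 _ (deltaPosEnd K m) ?_ fun k hk => ?_)
  · simp [jA, deltaPosEnd]
    norm_num
  · rcases k with _ | k
    · simp [jA, deltaPosEnd, xA]
      norm_num
    · rw [jA_of_coe_eq (c := (k : K) + 1) (k := k + 2)]
      · congr 1
        · simp; ring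
        · push_cast; congr 1; ring
      · simp only [deltaPosEnd, xA, LinearMap.coe_mk, AddHom.coe_mk, derivative_X_pow]
        simp; ring

theorem iota_deltaNegD (m : ℕ) : iota K m (deltaNegD K m) = deltaNeg K m := by
  rw [deltaNeg, ← monoB, ← toB_single]
  refine iota_eq_toB (rho_single_intertwine (-1) _ (deltaNegEnd K m) ?_ fun k hk => ?_)
  · simp [jA, deltaNegEnd]
  · rcases k with _ | k
    · simp [jA, deltaNegEnd, xA]
    · rw [jA_of_coe_eq (c := ((k : K) + 1) * (k + 1 - m)) (k := k)]
      · congr 1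
        · simp
        · push_cast; congr 1; ring
      · simp only [deltaNegEnd, xA, LinearMap.coe_mk, AddHom.coe_mk, derivative_X_pow,
          derivative_C_mul]
        rcases k with _ | k
        · simp
        · simp; ring

end CharZero

/-! ### The order on `σ`-orbits -/

/-- The action of `σ^n` on `K[h]`. -/
abbrev sp (n : ℤ) (f : K[X]) : K[X] := Multiplicative.ofAdd n • f

theorem sp_sp (n k : ℤ) (f : K[X]) : sp n (sp k f) = sp (n + k) f := by
  rw [sp, sp, sp, ofAdd_add, mul_smul]

theorem sp_zero (f : K[X]) : sp 0 f = f := by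
  rw [sp, ofAdd_zero, one_smul]

theorem sp_mul (n : ℤ) (f g : K[X]) : sp n (f * g) = sp n f * sp n g := smul_mul' _ _ _

theorem sp_ne_zero {n : ℤ} {f : K[X]} (hf : f ≠ 0) : sp n f ≠ 0 := (smul_ne_zero_iff_ne _).2 hf

theorem sp_dvd_sp (n : ℤ) {f g : K[X]} (h : f ∣ g) : sp n f ∣ sp n g := by
  obtain ⟨t, rfl⟩ := h
  exact ⟨sp n t, sp_mul n f t⟩

theorem sp_dvd_iff {n : ℤ} {f g : K[X]} : sp n f ∣ g ↔ f ∣ sp (-n) g := by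
  constructor
  · intro h
    have := sp_dvd_sp (-n) h
    rwa [sp_sp, neg_add_cancel, sp_zero] at this
  · intro h
    have := sp_dvd_sp n h
    rwa [sp_sp, add_neg_cancel, sp_zero] at this

theorem irreducible_sp (n : ℤ) {f : K[X]} (hf : Irreducible f) : Irreducible (sp n f) :=
  (MulEquiv.irreducible_iff (sigma K ^ n)).2 hf

theorem map_span_singleton (n : ℤ) (f : K[X]) :
    (Ideal.span {f}).map (sigma K ^ n) = Ideal.span {sp n f} := by
  rw [Ideal.map_span, Set.image_singleton]; rfl

/-- A common root of `σ^i α` and `γ` in an algebraic closure makes `i` a difference of a root of `γ`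
and a root of `α`. There are finitely many differences, and integers embed in characteristic zero.
-/
theorem finite_not_isCoprime [CharZero K] {α γ : K[X]} (hα : α ≠ 0) (hγ : γ ≠ 0) :
    {i : ℤ | ¬ IsCoprime (sp i α) γ}.Finite := by
  let L := AlgebraicClosure K
  have : CharZero L := charZero_of_injective_algebraMap (algebraMap K L).injective
  have hfin : (Set.image2 (fun z w : L => z - w) (γ.rootSet L) (α.rootSet L)).Finite :=
    (γ.rootSet_finite L).image2 _ (α.rootSet_finite L)
  refine (hfin.preimage (f := fun i : ℤ => (i : L)) Int.cast_injective.injOn).subset fun i hi => ?_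
  rw [Set.mem_ofPred_eq, isCoprime_iff_aeval_ne_zero_of_isAlgClosed K L] at hi
  push Not at hi
  obtain ⟨z, h1, h2⟩ := hi
  refine ⟨z, (mem_rootSet_of_ne hγ).2 h2, z - i, (mem_rootSet_of_ne hα).2 ?_, by simp⟩
  rw [sp, smul_eq_comp, aeval_comp] at h1
  simpa using h1

theorem finite_sp_dvd [CharZero K] {p g : K[X]} (hp : ¬ IsUnit p) (hg : g ≠ 0) :
    {i : ℤ | sp i p ∣ g}.Finite := by
  by_cases hp0 : p = 0
  · refine Set.finite_empty.subset fun i (hi : sp i p ∣ g) => hg ?_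
    rw [hp0, sp, smul_zero] at hi
    exact zero_dvd_iff.1 hi
  refine (finite_not_isCoprime hp0 hg).subset fun i (hi : sp i p ∣ g) hc => hp ?_
  have h1 : IsUnit (sp i p) := hc.isUnit_of_dvd' dvd_rfl hi
  have h2 : sp (-i) (sp i p) = p := by rw [sp_sp, neg_add_cancel, sp_zero]
  rw [← h2]
  exact h1.map (sigma K ^ (-i))

/-- The orbits of `σ` on primes are infinite: for `i ≠ 0`, iterating would give infinitely many
shifts of `p` dividing `p`. -/
theorem eq_zero_of_sp_dvd [CharZero K] {p : K[X]} (hp : Irreducible p) {i : ℤ}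
    (h : sp i p ∣ p) : i = 0 := by
  by_contra hi
  have key : ∀ n : ℕ, sp (n * i) p ∣ p := by
    intro n
    induction n with
    | zero => rw [Nat.cast_zero, zero_mul, sp_zero]
    | succ n ih =>
      have := (sp_dvd_sp i ih).trans h
      rw [sp_sp] at this
      convert this using 2
      push_cast; ring
  refine Set.infinite_of_injective_forall_mem (f := fun n : ℕ => (n * i : ℤ)) ?_ key
    (finite_sp_dvd hp.not_isUnit hp.ne_zero)
  intro a b hab
  simpa [hi] using hab

/-- This is the form in which the order is used. The exponent in `OrbitLT` is determined by the two
ideals, because `σ` acts freely on primes. -/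
theorem PolyLT.pos [CharZero K] {α β p : K[X]} (h : PolyLT α β) (hp : Irreducible p) {i : ℤ}
    (hα : p ∣ α) (hβ : sp i p ∣ β) : 0 < i := by
  obtain ⟨j, hj, hij⟩ := h (Ideal.span {p}) (Ideal.span {sp i p})
    (PrincipalIdealRing.isMaximal_of_irreducible hp)
    (PrincipalIdealRing.isMaximal_of_irreducible (irreducible_sp i hp))
    ⟨i, (map_span_singleton i p).symm⟩
    (Ideal.mem_span_singleton.2 hα) (Ideal.mem_span_singleton.2 hβ)
  rw [map_span_singleton, Ideal.span_singleton_eq_span_singleton] at hij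
  have h1 := sp_dvd_sp (-j) hij.dvd
  rw [sp_sp, sp_sp, neg_add_cancel, sp_zero] at h1
  have := eq_zero_of_sp_dvd hp h1
  omega

theorem exists_polyLT_sp [CharZero K] {α γ : K[X]} (hα : α ≠ 0) (hγ : γ ≠ 0) :
    ∃ N₀ : ℕ, ∀ N : ℕ, N₀ ≤ N → PolyLT (sp (-N) α) γ := by
  obtain ⟨N₀, hN₀⟩ := ((finite_not_isCoprime hα hγ).image Int.natAbs).bddAbove
  refine ⟨N₀ + 1, fun N hN p q _ hq ⟨i, hi⟩ hαp hγq => ⟨i, ?_, hi⟩⟩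
  have h1 : sp (i - N) α ∈ q := by
    have : sp i (sp (-N) α) ∈ q := by rw [hi]; exact Ideal.mem_map_of_mem (sigma K ^ i) hαp
    rwa [sp_sp] at this
  have h2 : i - N ∈ {i : ℤ | ¬ IsCoprime (sp i α) γ} := by
    rintro ⟨a, b, hab⟩
    refine hq.ne_top ((Ideal.eq_top_iff_one q).2 ?_)
    rw [← hab]
    exact add_mem (q.mul_mem_left a h1) (q.mul_mem_left b hγq)
  have := hN₀ (Set.mem_image_of_mem _ h2)
  omega

/-! ### Powers of `δ₁` and `δ₋₁` -/

theorem algebraMap_ratFunc_ne_zero {f : K[X]} (hf : f ≠ 0) : algebraMap K[X] (RatFunc K) f ≠ 0 :=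
  (map_ne_zero_iff _ (FaithfulSMul.algebraMap_injective K[X] (RatFunc K))).2 hf

theorem algebraMap_sp (n : ℤ) (f : K[X]) :
    algebraMap K[X] (RatFunc K) (sp n f) = sg n (algebraMap K[X] (RatFunc K) f) :=
  smul_algebraMap _ _

theorem exists_monoB_pow (n : ℤ) {f : K[X]} (hf : f ≠ 0) (k : ℕ) :
    ∃ P : K[X], P ≠ 0 ∧ monoB n (algebraMap K[X] (RatFunc K) f) ^ k =
      monoB (k * n) (algebraMap K[X] (RatFunc K) P) := by
  induction k with
  | zero => exact ⟨1, one_ne_zero, by rw [pow_zero, map_one, Nat.cast_zero, zero_mul]; rfl⟩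
  | succ k ih =>
    obtain ⟨P, hP, h⟩ := ih
    refine ⟨P * sp (k * n) f, mul_ne_zero hP (sp_ne_zero hf), ?_⟩
    rw [pow_succ, h, monoB_mul_monoB, map_mul, algebraMap_sp]
    congr 1
    push_cast; ring

theorem exists_deltaNeg_pow (m k : ℕ) : ∃ P : K[X], P ≠ 0 ∧ deltaNeg K m ^ k =
    monoB (-k) (algebraMap K[X] (RatFunc K) P) := by
  have h := exists_monoB_pow (-1) (f := X * (X - C (m : K)))
    (mul_ne_zero X_ne_zero (X_sub_C_ne_zero _)) k
  rwa [mul_neg_one] at h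

theorem ofD_mul_deltaNeg_pow (m k : ℕ) (f : K[X]) :
    ofD f * deltaNeg K m ^ k = deltaNeg K m ^ k * ofD (sp k f) := by
  obtain ⟨P, -, h⟩ := exists_deltaNeg_pow (K := K) m k
  rw [h, ofD_eq, ofD_eq, monoB_mul_monoB, monoB_mul_monoB, algebraMap_sp, sg_sg, neg_add_cancel,
    sg_zero, sg_zero, zero_add, add_zero, mul_comm]

section CharZero

variable [CharZero K]

theorem aeval_mul_deltaNegD_pow (m k : ℕ) (f : K[X]) :
    aeval (hD K m) f * deltaNegD K m ^ k = deltaNegD K m ^ k * aeval (hD K m) (sp k f) := by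
  apply iota_injective m
  rw [map_mul, map_mul, map_pow, iota_aeval, iota_aeval, iota_deltaNegD, ofD_mul_deltaNeg_pow]

theorem deltaPosD_mul_deltaNegD (m : ℕ) :
    deltaPosD K m * deltaNegD K m = aeval (hD K m) (sp 1 (definingElt K m)) := by
  apply iota_injective m
  rw [map_mul, iota_deltaPosD, iota_deltaNegD, iota_aeval, deltaNeg, ← monoB, monoB_mul_monoB,
    ← algebraMap_sp, ← map_mul, ofD_eq, add_neg_cancel, sp_mul, definingElt, sp_mul, sp_mul]
  congr 2
  simp only [sp, smul_eq_comp, sub_comp, X_comp, C_comp, Int.cast_one]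
  rw [show (2 : K) = 1 + 1 by norm_num, C_add]
  ring

theorem deltaPosD_pow_mul_deltaNegD_pow (m n : ℕ) :
    deltaPosD K m ^ n * deltaNegD K m ^ n =
      aeval (hD K m) (∏ i ∈ Finset.range n, sp (i + 1) (definingElt K m)) := by
  induction n with
  | zero => simp
  | succ n ih =>
    rw [pow_succ, pow_succ', mul_assoc, ← mul_assoc (deltaPosD K m), deltaPosD_mul_deltaNegD,
      aeval_mul_deltaNegD_pow, ← mul_assoc, ih, ← map_mul, Finset.prod_range_succ, sp_sp]

/-- `K[h]` is large in `𝒟(A)`: every element of `B` is a left fraction of elements of `𝒟(A)` with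
denominator in `K[h]`. -/
theorem exists_ofD_mul_eq_iota (m : ℕ) (c : B K) :
    ∃ s : K[X], s ≠ 0 ∧ ∃ r : DA K m, iota K m r = ofD s * c := by
  induction c using SkewMonoidAlgebra.induction_on with
  | zero => exact ⟨1, one_ne_zero, 0, by simp⟩
  | add c d hc hd =>
    obtain ⟨s, hs, r, hr⟩ := hc
    obtain ⟨t, ht, q, hq⟩ := hd
    refine ⟨s * t, mul_ne_zero hs ht, aeval (hD K m) t * r + aeval (hD K m) s * q, ?_⟩
    rw [map_add, map_mul, map_mul, iota_aeval, iota_aeval, hr, hq, ← mul_assoc, ← mul_assoc,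
      ← ofD_mul, ← ofD_mul, mul_comm t, mul_add]
  | single g f =>
    obtain ⟨n, rfl⟩ := Multiplicative.ofAdd.surjective g
    have hδ : ∃ P : K[X], P ≠ 0 ∧ ∃ r : DA K m,
        iota K m r = monoB n (algebraMap K[X] (RatFunc K) P) := by
      obtain ⟨k, rfl | rfl⟩ := Int.eq_nat_or_neg n
      · obtain ⟨P, hP, h⟩ := exists_monoB_pow 1 (X_sub_C_ne_zero (2 : K)) k
        exact ⟨P, hP, deltaPosD K m ^ k, by rw [map_pow, iota_deltaPosD, h, mul_one]⟩
      · obtain ⟨P, hP, h⟩ := exists_deltaNeg_pow (K := K) m k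
        exact ⟨P, hP, deltaNegD K m ^ k, by rw [map_pow, iota_deltaNegD, h]⟩
    obtain ⟨P, hP, r, hr⟩ := hδ
    -- With `P x^n` in `𝒟(A)`, the element `num(f) P x^n` is also there, and it equals `P denom(f)`
    -- times `f x^n`.
    refine ⟨P * f.denom, mul_ne_zero hP f.denom_ne_zero, aeval (hD K m) f.num * r, ?_⟩
    rw [map_mul, iota_aeval, hr, ofD_eq, ofD_eq, ← monoB, monoB_mul_monoB, monoB_mul_monoB,
      sg_zero, sg_zero]
    congr 1
    have h1 := f.num_div_denom
    rw [div_eq_iff (algebraMap_ratFunc_ne_zero f.denom_ne_zero)] at h1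
    rw [h1, map_mul]
    ring

/-- Let `L ∩ K[h] = (g)`, and suppose a prime `p` divides `g`. Among the finitely many shifts of `p`
dividing `g`, let `σ^M p` be the highest and `σ^N p` the lowest. Isolating the constant term of the
normal element shows `σ^M p ∣ β₀`; isolating its top term shows that a shift of `p` by at most `N`
divides `a` or `β n`. As `N ≤ M`, this contradicts the order conditions. -/
theorem one_mem_of_isNormal {m n : ℕ} {β : ℕ → K[X]} (h1 : PolyLT (β 0) (β n))
    (h2 : PolyLT (β 0) (definingElt K m)) {L : Ideal (DA K m)} {f : K[X]} (hf : f ≠ 0)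
    (hfL : aeval (hD K m) f ∈ L)
    (hb : ∑ i ∈ Finset.range (n + 1), deltaNegD K m ^ i * aeval (hD K m) (β i) ∈ L) :
    (1 : DA K m) ∈ L := by
  by_contra h1L
  obtain ⟨g, hg⟩ :=
    (IsPrincipalIdealRing.principal (L.comap (aeval (hD K m) : K[X] →ₐ[K] DA K m).toRingHom)).1
  have hmem : ∀ t : K[X], aeval (hD K m) t ∈ L ↔ g ∣ t := fun t => by
    rw [← Ideal.mem_span_singleton, ← Ideal.submodule_span_eq, ← hg]; rfl
  have hg0 : g ≠ 0 := by
    rintro rfl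
    exact hf (zero_dvd_iff.1 ((hmem f).1 hfL))
  have hgu : ¬ IsUnit g := fun h => h1L (by
    have := (hmem 1).2 (h.dvd)
    rwa [map_one] at this)
  obtain ⟨p, hp, hpg⟩ := WfDvdMonoid.exists_irreducible_factor hgu hg0
  have hfin := finite_sp_dvd hp.not_isUnit hg0
  have hne : {i : ℤ | sp i p ∣ g}.Nonempty := ⟨0, by rwa [Set.mem_ofPred_eq, sp_zero]⟩
  obtain ⟨M, hM, hMmax⟩ := Set.exists_max_image _ id hfin hne
  obtain ⟨N, hN, hNmin⟩ := Set.exists_min_image _ id hfin hne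
  have hNM : N ≤ M := hMmax N hN
  rw [Set.mem_ofPred_eq] at hM hN
  -- Moving `σ^{-i}(g)` to the right past `δ₋₁^i` turns it into `g`, which lies in `L`. Products of
  -- such shifts therefore remove chosen terms of the sum.
  have hkill : ∀ (i : ℕ) (t u : K[X]), sp (-i) g ∣ t →
      aeval (hD K m) t * (deltaNegD K m ^ i * aeval (hD K m) u) ∈ L := by
    rintro i _ u ⟨t, rfl⟩
    have h3 : aeval (hD K m) (sp (-i) g * t) * (deltaNegD K m ^ i * aeval (hD K m) u) =
        (aeval (hD K m) t * deltaNegD K m ^ i * aeval (hD K m) u) * aeval (hD K m) g := by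
      rw [mul_comm, map_mul, mul_assoc, ← mul_assoc _ (deltaNegD K m ^ i),
        aeval_mul_deltaNegD_pow, sp_sp, add_neg_cancel, sp_zero, mul_assoc, mul_assoc, mul_assoc,
        ← map_mul, mul_comm g, map_mul]
    rw [h3]
    exact L.mul_mem_left _ ((hmem g).2 dvd_rfl)
  -- The product of `σ^{-1}(g), …, σ^{-n}(g)` removes every term except `β 0`. By maximality of `M`,
  -- none of these factors is divisible by `σ^M p`.
  have hlow : sp M p ∣ β 0 := by
    have h3 := L.mul_mem_left
      (aeval (hD K m) (∏ i ∈ Finset.range n, sp (-((i + 1 : ℕ) : ℤ)) g)) hb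
    rw [Finset.mul_sum, Finset.sum_range_succ', pow_zero, one_mul, ← map_mul] at h3
    have h4 := (L.add_mem_iff_right (Ideal.sum_mem _ fun i hi => ?_)).1 h3
    · have h5 := hM.trans ((hmem _).1 h4)
      refine ((irreducible_sp M hp).prime.dvd_or_dvd h5).resolve_left fun h6 => ?_
      obtain ⟨i, -, hi⟩ := ((irreducible_sp M hp).prime.dvd_finsetProd_iff _).1 h6
      rw [← sp_dvd_iff, sp_sp] at hi
      have := hMmax _ hi
      simp only [id] at this
      omega
    · exact hkill (i + 1) _ _ (Finset.dvd_prod_of_mem _ hi)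
  -- The shifts `σ^0(g), …, σ^{-(n-1)}(g)` remove every term except the top one. Left multiplication
  -- by `δ₁^n` then brings what remains into `K[h]`, at the cost of shifts of `a`.
  have hhigh : sp N p ∣ (∏ i ∈ Finset.range n, sp (i + 1) (definingElt K m)) *
      sp n (∏ i ∈ Finset.range n, sp (-(i : ℤ)) g) * β n := by
    have h3 := L.mul_mem_left (aeval (hD K m) (∏ i ∈ Finset.range n, sp (-(i : ℤ)) g)) hb
    rw [Finset.mul_sum, Finset.sum_range_succ] at h3
    have h4 := (L.add_mem_iff_right (Ideal.sum_mem _ fun i hi => ?_)).1 h3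
    · have h5 := L.mul_mem_left (deltaPosD K m ^ n) h4
      rw [← mul_assoc (aeval _ _), aeval_mul_deltaNegD_pow, ← mul_assoc, ← mul_assoc,
        deltaPosD_pow_mul_deltaNegD_pow, ← map_mul, ← map_mul] at h5
      exact hN.trans ((hmem _).1 h5)
    · exact hkill i _ _ (Finset.dvd_prod_of_mem _ hi)
  have hsp : ∀ k : ℤ, sp k (sp M p) = sp (k + M) p := fun k => sp_sp k M p
  have hq := (irreducible_sp N hp).prime
  -- The three possibilities contradict, in turn, `β₀ < a`, the minimality of `N`, and `β₀ < β n`.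
  rcases hq.dvd_or_dvd hhigh with h3 | h3
  · rcases hq.dvd_or_dvd h3 with h4 | h4
    · obtain ⟨i, -, hi⟩ := (hq.dvd_finsetProd_iff _).1 h4
      rw [← neg_neg ((i : ℤ) + 1), ← sp_dvd_iff, sp_sp] at hi
      have := h2.pos (irreducible_sp M hp) (i := -(i + 1) + N - M) hlow
        (by rwa [sp_sp, sub_add_cancel])
      omega
    · rw [← neg_neg (n : ℤ), ← sp_dvd_iff, sp_sp] at h4
      obtain ⟨i, hi, hi'⟩ := ((irreducible_sp _ hp).prime.dvd_finsetProd_iff _).1 h4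
      rw [← sp_dvd_iff, sp_sp] at hi'
      have := hNmin _ hi'
      have := Finset.mem_range.1 hi
      simp only [id] at *
      omega
  · have := h1.pos (irreducible_sp M hp) (i := N - M) hlow (by rwa [sp_sp, sub_add_cancel])
    omega

end CharZero

/-! ### Normal forms -/

theorem SuppIn.eq_sum {b : B K} {n : ℕ} (hb : SuppIn b (-n) (n + 1)) :
    b = ∑ i ∈ Finset.range (n + 1), monoB (-(i : ℤ)) (b.coeff (.ofAdd (-(i : ℤ)))) := by
  rw [← sub_eq_zero]
  refine eq_zero_of_coeff fun k => ?_
  have hsum : (∑ i ∈ Finset.range (n + 1),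
      monoB (-(i : ℤ)) (b.coeff (.ofAdd (-(i : ℤ))))).coeff (.ofAdd k) =
      ∑ i ∈ Finset.range (n + 1), if i = -k then b.coeff (.ofAdd k) else 0 := by
    have := map_sum (SkewMonoidAlgebra.coeffAddEquiv (k := RatFunc K) (G := Multiplicative ℤ))
      (fun i : ℕ => monoB (-(i : ℤ)) (b.coeff (.ofAdd (-(i : ℤ))))) (Finset.range (n + 1))
    refine (DFunLike.congr_fun this (.ofAdd k)).trans ?_
    rw [Finsupp.finsetSum_apply]
    refine Finset.sum_congr rfl fun i _ => ?_
    change (SkewMonoidAlgebra.coeff (monoB _ _)) _ = _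
    rw [SkewMonoidAlgebra.coeff_single]
    by_cases h : (i : ℤ) = -k
    · rw [if_pos h, h, neg_neg, Finsupp.single_eq_same]
    · rw [if_neg h, Finsupp.single_eq_of_ne]
      intro h'
      exact h (by have := Multiplicative.ofAdd.injective h'; omega)
  rw [SkewMonoidAlgebra.coeff_sub, Finsupp.sub_apply, hsum, sub_eq_zero]
  by_cases h : b.coeff (.ofAdd k) = 0
  · simp [h]
  · have hk := hb k h
    push_cast at hk
    rw [Finset.sum_eq_single (-k).toNat, if_pos (by omega)]
    · intro i _ hi
      rw [if_neg (by omega)]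
    · intro hi
      exact absurd (Finset.mem_range.2 (by omega)) hi

/-- A support interval of minimal width has nonzero coefficients at both ends; a power of `x` moves
its upper end to `0`. -/
theorem exists_shift_suppIn {b : B K} (hb : b ≠ 0) : ∃ (k : ℤ) (n : ℕ),
    SuppIn (monoB k 1 * b) (-n) (n + 1) ∧ (monoB k 1 * b).coeff (.ofAdd 0) ≠ 0 ∧
      (monoB k 1 * b).coeff (.ofAdd (-(n : ℤ))) ≠ 0 := by
  classical
  have hW : ∃ w : ℕ, ∃ l, SuppIn b l w := by
    obtain ⟨l, w, h⟩ := exists_suppIn b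
    exact ⟨w, l, h⟩
  obtain ⟨l, hl⟩ := Nat.find_spec hW
  have hmin := fun w (hw : w < Nat.find hW) => Nat.find_min hW hw
  generalize Nat.find hW = w at hl hmin
  rcases w with _ | n
  · exact absurd hl.eq_zero hb
  refine ⟨-(l + n), n, fun k hk => ?_, ?_, ?_⟩
  · rw [coeff_monoB_mul, one_mul] at hk
    have : b.coeff (.ofAdd (k - -(l + n))) ≠ 0 := fun h => by
      rw [h, sg_map_zero] at hk
      exact hk rfl
    have := hl _ this
    push_cast at this ⊢
    omega
  · rw [coeff_monoB_mul, one_mul]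
    refine sg_ne_zero fun h => hmin n (Nat.lt_succ_self n) ⟨l, fun k hk => ?_⟩
    have h1 := hl k hk
    have h2 : k ≠ 0 - -(l + n) := by rintro rfl; exact hk h
    push_cast at h1
    omega
  · rw [coeff_monoB_mul, one_mul]
    refine sg_ne_zero fun h => hmin n (Nat.lt_succ_self n) ⟨l + 1, fun k hk => ?_⟩
    have h1 := hl k hk
    have h2 : k ≠ -(n : ℤ) - -(l + n) := by rintro rfl; exact hk h
    push_cast at h1
    omega

theorem monoB_eq_deltaNeg_pow_mul (m i : ℕ) (f : RatFunc K) :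
    ∃ g : RatFunc K, (f ≠ 0 → g ≠ 0) ∧ monoB (-(i : ℤ)) f = deltaNeg K m ^ i * monoB 0 g := by
  obtain ⟨P, hP, h⟩ := exists_deltaNeg_pow (K := K) m i
  have hP' := algebraMap_ratFunc_ne_zero hP
  refine ⟨sg i ((algebraMap K[X] (RatFunc K) P)⁻¹ * f),
    fun hf => sg_ne_zero (mul_ne_zero (inv_ne_zero hP') hf), ?_⟩
  rw [h, monoB_mul_monoB, sg_sg, neg_add_cancel, sg_zero, add_zero, mul_inv_cancel_left₀ hP']

/-- Over `K(h)`, `δ₋₁^i` and `x^{-i}` differ by an invertible coefficient. With the coefficients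
written on the right, one right factor `s` clears all denominators. -/
theorem exists_mul_eq_sum_deltaNeg (m : ℕ) {b : B K} (hb : b ≠ 0) :
    ∃ (k : ℤ) (s : K[X]) (n : ℕ) (β : ℕ → K[X]), s ≠ 0 ∧ β 0 ≠ 0 ∧ β n ≠ 0 ∧
      monoB k 1 * b * ofD s = ∑ i ∈ Finset.range (n + 1), deltaNeg K m ^ i * ofD (β i) := by
  obtain ⟨k, n, h, h0, hn⟩ := exists_shift_suppIn hb
  choose g hg0 hg using fun i : ℕ =>
    monoB_eq_deltaNeg_pow_mul m i ((monoB k 1 * b).coeff (.ofAdd (-(i : ℤ))))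
  obtain ⟨s, hs⟩ := IsLocalization.exist_integer_multiples (nonZeroDivisors K[X])
    (Finset.range (n + 1)) g
  have hs0 : (s : K[X]) ≠ 0 := nonZeroDivisors.ne_zero s.2
  choose! β hβ using hs
  have hβ' : ∀ i ∈ Finset.range (n + 1), algebraMap K[X] (RatFunc K) (β i) =
      g i * algebraMap K[X] (RatFunc K) s := fun i hi => by
    rw [hβ i hi, Algebra.smul_def, mul_comm]
  have hne : ∀ i ∈ Finset.range (n + 1),
      (monoB k 1 * b).coeff (.ofAdd (-(i : ℤ))) ≠ 0 → β i ≠ 0 := by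
    intro i hi hi' hβ0
    have := hβ' i hi
    rw [hβ0, map_zero, eq_comm, mul_eq_zero] at this
    exact this.elim (hg0 i hi') (algebraMap_ratFunc_ne_zero hs0)
  refine ⟨k, s, n, β, hs0, hne 0 (by simp) (by simpa using h0), hne n (by simp) hn, ?_⟩
  conv_lhs => rw [h.eq_sum]
  rw [Finset.sum_mul]
  refine Finset.sum_congr rfl fun i hi => ?_
  rw [hg i, mul_assoc, ofD_eq, ofD_eq, monoB_mul_monoB, add_zero, sg_zero, hβ' i hi]

/-- Take `u = σ^{-1}(z) ⋯ σ^{-N}(z)`. Then `σ(u) / u = z / σ^{-N}(z)` by telescoping, and the case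
of general `i` is the product of the shifts of this relation. -/
theorem exists_sp_one_mul_eq {z : K[X]} (hz : z ≠ 0) (N : ℕ) :
    ∃ u : K[X], u ≠ 0 ∧ ∀ i : ℕ, sp i u * ∏ k ∈ Finset.range i, sp k (sp (-N) z) =
      (∏ k ∈ Finset.range i, sp k z) * u := by
  have h1 : ∃ u : K[X], u ≠ 0 ∧ sp 1 u * sp (-N) z = z * u := by
    induction N with
    | zero => exact ⟨1, one_ne_zero, by
        rw [sp, smul_one, Nat.cast_zero, neg_zero, sp_zero, one_mul, mul_one]⟩
    | succ N ih =>
      obtain ⟨u, hu, h⟩ := ih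
      refine ⟨u * sp (-(N + 1 : ℕ)) z, mul_ne_zero hu (sp_ne_zero hz), ?_⟩
      rw [sp_mul, sp_sp, show (1 : ℤ) + -(N + 1 : ℕ) = -N by push_cast; ring, h, mul_assoc]
  obtain ⟨u, hu, h⟩ := h1
  refine ⟨u, hu, fun i => ?_⟩
  induction i with
  | zero =>
    simp only [Finset.range_zero, Finset.prod_empty, Nat.cast_zero, sp_zero, mul_one, one_mul]
  | succ i ih =>
    have h2 := congrArg (sp i) h
    rw [sp_mul, sp_sp, sp_mul] at h2
    rw [Finset.prod_range_succ, Finset.prod_range_succ, mul_left_comm, Nat.cast_succ, h2,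
      mul_right_comm, ← ih]
    ring

/-! ### Simplicity of `M_b` -/

/-- Each module is the quotient of `R` by the common annihilator of `v` and `w`. -/
theorem nonempty_equiv_of_smul_eq_zero_iff {R M N : Type*} [Ring R] [AddCommGroup M]
    [AddCommGroup N] [Module R M] [Module R N] [IsSimpleModule R M] [IsSimpleModule R N] {v : M}
    {w : N} (hv : v ≠ 0) (hw : w ≠ 0) (h : ∀ r : R, r • v = 0 ↔ r • w = 0) :
    Nonempty (M ≃ₗ[R] N) := by
  have hker : LinearMap.ker (LinearMap.toSpanSingleton R M v) =
      LinearMap.ker (LinearMap.toSpanSingleton R N w) := by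
    ext r
    simpa using h r
  exact ⟨((LinearMap.toSpanSingleton R M v).quotKerEquivOfSurjective
      (IsSimpleModule.toSpanSingleton_surjective R hv)).symm.trans
    ((Submodule.quotEquivOfEq _ _ hker).trans
      ((LinearMap.toSpanSingleton R N w).quotKerEquivOfSurjective
        (IsSimpleModule.toSpanSingleton_surjective R hw)))⟩

theorem exists_mem_iff_mul_mem_of_equiv {R : Type*} [Ring R] {I J : Ideal R}
    (φ : (R ⧸ I) ≃ₗ[R] (R ⧸ J)) : ∃ d : R, ∀ r : R, r ∈ I ↔ r * d ∈ J := by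
  obtain ⟨d, hd⟩ := Submodule.Quotient.mk_surjective J (φ (Submodule.Quotient.mk 1))
  refine ⟨d, fun r => ?_⟩
  have h : Submodule.Quotient.mk (p := J) (r * d) = φ (Submodule.Quotient.mk r) := by
    rw [← smul_eq_mul, Submodule.Quotient.mk_smul, hd, ← map_smul, ← Submodule.Quotient.mk_smul,
      smul_eq_mul, mul_one]
  rw [← Submodule.Quotient.mk_eq_zero J, h, φ.map_eq_zero_iff, Submodule.Quotient.mk_eq_zero]

theorem ofD_mul_mem_iff {f : K[X]} (hf : f ≠ 0) {c : B K} {I : Ideal (B K)} :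
    ofD f * c ∈ I ↔ c ∈ I := by
  refine ⟨fun h => ?_, fun h => I.mul_mem_left _ h⟩
  obtain ⟨v, hv⟩ := (isUnit_ofD hf).exists_left_inv
  have := I.mul_mem_left v h
  rwa [← mul_assoc, hv, one_mul] at this

variable [CharZero K]

theorem mem_leftIdeal {m : ℕ} {b : B K} {r : DA K m} :
    r ∈ leftIdeal m b ↔ iota K m r ∈ Ideal.span {b} := Iff.rfl

/-- Nonzero polynomials in `h` are units of `B`, so they can be cancelled on the left modulo `Bb`.
-/
theorem isDTorsionFree_Mb (m : ℕ) (b : B K) : IsDTorsionFree K m (Mb m b) := by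
  intro f hf v hv
  obtain ⟨r, rfl⟩ := Submodule.Quotient.mk_surjective _ v
  rw [← Submodule.Quotient.mk_smul, Submodule.Quotient.mk_eq_zero, smul_eq_mul, mem_leftIdeal,
    map_mul, iota_aeval, ofD_mul_mem_iff hf] at hv
  rwa [Submodule.Quotient.mk_eq_zero]

theorem isSimpleModule_Mb {m : ℕ} {b : B K} (hn : IsNormalElt m b) (hb : Irreducible b) :
    IsSimpleModule (DA K m) (Mb m b) := by
  rw [isSimpleModule_iff_isCoatom]
  refine ⟨fun h => ?_, fun L hL => ?_⟩
  · have : (1 : DA K m) ∈ leftIdeal m b := by rw [h]; trivial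
    rw [mem_leftIdeal, map_one] at this
    exact one_notMem_span hb.not_isUnit this
  · obtain ⟨r, hrL, hr⟩ := SetLike.exists_of_lt hL
    obtain ⟨p, q, hpq⟩ := span_singleton_sup_eq_top hb hr
    obtain ⟨s, hs, p', hp'⟩ := exists_ofD_mul_eq_iota m p
    -- Clearing the denominator of `p` in `p r + q b = 1` gives `s = p' r + (s q) b`. Hence `s - p'
    -- r` lies in `𝒟(A) ∩ Bb`, and `s` lies in `L`.
    have hsL : aeval (hD K m) s ∈ L := by
      have h1 : aeval (hD K m) s - p' * r ∈ L := by
        refine hL.le ?_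
        rw [mem_leftIdeal, map_sub, map_mul, iota_aeval, hp']
        refine Ideal.mem_span_singleton'.2 ⟨ofD s * q, ?_⟩
        rw [eq_sub_iff_add_eq, mul_assoc, mul_assoc, ← mul_add, add_comm, hpq, mul_one]
      simpa using add_mem h1 (Ideal.mul_mem_left _ p' hrL)
    obtain ⟨n, -, β, -, -, hbβ, h1, h2⟩ := hn
    refine (Ideal.eq_top_iff_one L).2 (one_mem_of_isNormal h1 h2 hs hsL (hL.le ?_))
    rw [mem_leftIdeal, map_sum]
    simp only [map_mul, map_pow, iota_deltaNegD, iota_aeval]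
    rw [← hbβ]
    exact Ideal.mem_span_singleton_self b

/-- Right multiplication by `e` induces an injection `B/Bb → B/Bb'`, as `Bb` is maximal. Scaling by
`t` with `t e ∈ 𝒟(A)` yields nonzero classes of `t` and `t e` with equal annihilators in `𝒟(A)`. -/
theorem Mb_nonempty_equiv {m : ℕ} {b b' e : B K} (hb : Irreducible b)
    [IsSimpleModule (DA K m) (Mb m b)] [IsSimpleModule (DA K m) (Mb m b')]
    (he : e ∉ Ideal.span {b'}) (hbe : b * e ∈ Ideal.span {b'}) :
    Nonempty (Mb m b ≃ₗ[DA K m] Mb m b') := by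
  obtain ⟨t, ht, r, hr⟩ := exists_ofD_mul_eq_iota m e
  refine nonempty_equiv_of_smul_eq_zero_iff (R := DA K m)
    (v := Submodule.Quotient.mk (aeval (hD K m) t)) (w := Submodule.Quotient.mk r) ?_ ?_ ?_
  · rw [Ne, Submodule.Quotient.mk_eq_zero, mem_leftIdeal, iota_aeval, ← mul_one (ofD t),
      ofD_mul_mem_iff ht]
    exact one_notMem_span hb.not_isUnit
  · rwa [Ne, Submodule.Quotient.mk_eq_zero, mem_leftIdeal, hr, ofD_mul_mem_iff ht]
  · intro q
    rw [← Submodule.Quotient.mk_smul, ← Submodule.Quotient.mk_smul, Submodule.Quotient.mk_eq_zero,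
      Submodule.Quotient.mk_eq_zero, smul_eq_mul, smul_eq_mul, mem_leftIdeal, mem_leftIdeal,
      map_mul, map_mul, iota_aeval, hr, ← mul_assoc]
    generalize iota K m q * ofD t = c
    constructor
    · intro hc
      obtain ⟨u, rfl⟩ := Ideal.mem_span_singleton'.1 hc
      rw [mul_assoc]
      exact Ideal.mul_mem_left _ u hbe
    · intro hc
      by_contra hcb
      obtain ⟨p, q, hpq⟩ := span_singleton_sup_eq_top hb hcb
      apply he
      rw [← one_mul e, ← hpq, add_mul, mul_assoc, mul_assoc]
      exact add_mem (Ideal.mul_mem_left _ p hc) (Ideal.mul_mem_left _ q hbe)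

theorem nonempty_equiv_iff_areSimilar {m : ℕ} {b b' : B K} (hb : Irreducible b)
    (hb' : Irreducible b')
    [IsSimpleModule (DA K m) (Mb m b)] [IsSimpleModule (DA K m) (Mb m b')] :
    Nonempty (Mb m b ≃ₗ[DA K m] Mb m b') ↔ AreSimilar b b' := by
  constructor
  · rintro ⟨φ⟩
    obtain ⟨d, hd⟩ := exists_mem_iff_mul_mem_of_equiv φ
    have hR : ∀ r : DA K m, iota K m r ∈ Ideal.span {b} ↔
        iota K m r * iota K m d ∈ Ideal.span {b'} := by
      intro r
      rw [← map_mul, ← mem_leftIdeal, ← mem_leftIdeal, hd]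
    -- The equivalence extends from `𝒟(A)` to `B` by clearing the denominator of `c` on the left.
    have hB : ∀ c : B K, c ∈ Ideal.span {b} ↔ c * iota K m d ∈ Ideal.span {b'} := by
      intro c
      obtain ⟨s, hs, r, hr⟩ := exists_ofD_mul_eq_iota m c
      rw [← ofD_mul_mem_iff hs, ← hr, hR, hr, mul_assoc, ofD_mul_mem_iff hs]
    have hd' : iota K m d ∉ Ideal.span {b'} := fun h =>
      one_notMem_span hb.not_isUnit ((hB 1).2 (by rwa [one_mul]))
    obtain ⟨p, q, hpq⟩ := span_singleton_sup_eq_top hb' hd'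
    refine ⟨iota K m d, ⟨⟨b', (mul_one _).symm⟩, ⟨_, (mul_one _).symm⟩, ?_⟩,
      ⟨?_, ⟨b, rfl⟩, ?_⟩⟩
    · rintro e ⟨u, hu⟩ ⟨v, hv⟩
      refine ⟨p * v + q * u, ?_⟩
      rw [add_mul, mul_assoc, mul_assoc, ← hu, ← hv, hpq]
    · obtain ⟨u, hu⟩ := Ideal.mem_span_singleton'.1 ((hB b).1 (Ideal.mem_span_singleton_self b))
      exact ⟨u, hu.symm⟩
    · rintro e ⟨u, hu⟩ ⟨v, rfl⟩
      obtain ⟨w, hw⟩ := Ideal.mem_span_singleton'.1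
        ((hB v).2 (Ideal.mem_span_singleton'.2 ⟨u, hu.symm⟩))
      exact ⟨w, by rw [← mul_assoc, hw]⟩
  · rintro ⟨d, ⟨-, -, h1⟩, ⟨⟨u, hu⟩, -, -⟩⟩
    refine Mb_nonempty_equiv hb (e := d) (fun hd => ?_) (Ideal.mem_span_singleton'.2 ⟨u, hu.symm⟩)
    obtain ⟨v, hv⟩ := Ideal.mem_span_singleton'.1 hd
    obtain ⟨w, hw⟩ := h1 b' ⟨1, (one_mul _).symm⟩ ⟨v, hv.symm⟩
    exact hb'.not_isUnit (isUnit_of_mul_eq_one_B hw.symm).2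

/-! ### Existence of normal elements -/

theorem exists_isNormalElt (m : ℕ) {b : B K} (hb : Irreducible b) :
    ∃ p q : B K, IsUnit p ∧ IsUnit q ∧ IsNormalElt m (p * b * q) := by
  obtain ⟨k, s, n, β, hs, hβ0, hβn, h⟩ := exists_mul_eq_sum_deltaNeg m hb.ne_zero
  have hpk : IsUnit (monoB k (1 : RatFunc K)) := isUnit_monoB k one_ne_zero
  have hn : 1 ≤ n := by
    -- For `n = 0` the irreducible element would be a nonzero polynomial in `h`, hence a unit.
    by_contra hn
    obtain rfl : n = 0 := by omega
    have h1 : Irreducible (monoB k 1 * b * ofD s) :=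
      (irreducible_mul_isUnit (isUnit_ofD hs)).2 ((irreducible_isUnit_mul hpk).2 hb)
    rw [h] at h1
    refine h1.not_isUnit ?_
    simpa using isUnit_ofD hβ0
  set z := β 0 with hz
  obtain ⟨n, rfl⟩ : ∃ n', n = n' + 1 := ⟨n - 1, by omega⟩
  have hZ : ∏ k ∈ Finset.range (n + 1), sp k z ≠ 0 :=
    Finset.prod_ne_zero_iff.2 fun k _ => sp_ne_zero hβ0
  have hγ : β (n + 1) * ∏ k ∈ Finset.range n, sp (k + 1) z ≠ 0 :=
    mul_ne_zero hβn (Finset.prod_ne_zero_iff.2 fun k _ => sp_ne_zero hβ0)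
  have ha : definingElt K m ≠ 0 :=
    mul_ne_zero (mul_ne_zero X_ne_zero (X_sub_C_ne_zero _)) (X_sub_C_ne_zero _)
  obtain ⟨N₁, hN₁⟩ := exists_polyLT_sp hZ hγ
  obtain ⟨N₂, hN₂⟩ := exists_polyLT_sp hZ ha
  obtain ⟨N, h1, h2⟩ : ∃ N, N₁ ≤ N ∧ N₂ ≤ N := ⟨_, le_max_left _ _, le_max_right _ _⟩
  obtain ⟨u, hu, hui⟩ := exists_sp_one_mul_eq hβ0 N
  set Y := ∏ k ∈ Finset.range (n + 1), sp k (sp (-N) z) with hY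
  -- The new constant term is a fixed polynomial shifted by `-N`, so a large `N` puts it below both
  -- `a` and the new top coefficient, which does not depend on `N`.
  have hYZ : Y = sp (-N) (∏ k ∈ Finset.range (n + 1), sp k z) := by
    change _ = Multiplicative.ofAdd (-(N : ℤ)) • _
    rw [hY, Finset.smul_prod']
    refine Finset.prod_congr rfl fun k _ => ?_
    change sp _ _ = sp _ (sp _ _)
    rw [sp_sp, sp_sp, add_comm]
  have hY0 : Y ≠ 0 := by rw [hYZ]; exact sp_ne_zero hZ
  let β' : ℕ → K[X]
    | 0 => Y
    | i + 1 => β (i + 1) * (∏ k ∈ Finset.range i, sp (k + 1) z) *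
        ∏ k ∈ Finset.Ico (i + 1) (n + 1), sp k (sp (-N) z)
  -- Multiplying by `u` on the left and by `Y / (z u)` on the right changes the coefficient of
  -- `δ₋₁^i` into `σ^i(u) β_i Y / (z u)`. By the choice of `u` and `Y` this is the polynomial `β'
  -- i`.
  have hβ' : ∀ i ≤ n + 1, sp i u * β i * Y = β' i * (z * u) := by
    rintro (_ | i) hi
    · rw [Nat.cast_zero, sp_zero]
      change u * z * Y = Y * _
      ring
    · change _ = β (i + 1) * _ * _ * _
      have h3 := hui (i + 1)
      rw [Finset.prod_range_succ' (fun k : ℕ => sp (k : ℤ) z)] at h3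
      simp only [Nat.cast_succ, Nat.cast_zero, sp_zero] at h3
      rw [hY, ← Finset.prod_range_mul_prod_Ico _ hi]
      push_cast
      linear_combination (β (i + 1) *
        ∏ k ∈ Finset.Ico (i + 1) (n + 1), sp k (sp (-N) z)) * h3
  have hzu := algebraMap_ratFunc_ne_zero (mul_ne_zero hβ0 hu)
  set γ : RatFunc K := algebraMap K[X] (RatFunc K) Y / algebraMap K[X] (RatFunc K) (z * u) with hγ'
  refine ⟨ofD u * monoB k 1, ofD s * monoB 0 γ, (isUnit_ofD hu).mul hpk,
    (isUnit_ofD hs).mul (isUnit_monoB 0 (div_ne_zero (algebraMap_ratFunc_ne_zero hY0) hzu)),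
    n + 1, hn, β', ?_, hY0, ?_, ?_, ?_⟩
  · change β (n + 1) * _ * _ ≠ 0
    rw [Finset.Ico_self, Finset.prod_empty, mul_one]
    exact hγ
  · have h3 : ofD u * monoB k 1 * b * (ofD s * monoB 0 γ) =
        ofD u * (monoB k 1 * b * ofD s) * monoB 0 γ := by simp only [mul_assoc]
    rw [h3, h, Finset.mul_sum, Finset.sum_mul]
    refine Finset.sum_congr rfl fun i hi => ?_
    rw [← mul_assoc, ofD_mul_deltaNeg_pow, mul_assoc, mul_assoc, ← mul_assoc (ofD _), ← ofD_mul,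
      ofD_eq, ofD_eq, monoB_mul_monoB, add_zero, sg_zero, hγ', mul_div_assoc', ← map_mul,
      hβ' i (by have := Finset.mem_range.1 hi; omega), map_mul, mul_div_cancel_right₀ _ hzu]
  · change PolyLT Y (β (n + 1) * _ * _)
    rw [Finset.Ico_self, Finset.prod_empty, mul_one, hYZ]
    exact hN₁ N h1
  · change PolyLT Y _
    rw [hYZ]
    exact hN₂ N h2

/-! ### The classification -/

/-- The left ideal of all `c ∈ B` that have a left multiple `s c ∈ 𝒟(A)`, `0 ≠ s ∈ K[h]`, which
annihilates `v`. -/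
def annB (m : ℕ) {M : Type*} [AddCommGroup M] [Module (DA K m) M] (v : M) : Ideal (B K) where
  carrier := {c | ∃ s : K[X], s ≠ 0 ∧ ∃ r : DA K m, iota K m r = ofD s * c ∧ r • v = 0}
  zero_mem' := ⟨1, one_ne_zero, 0, by simp, zero_smul _ _⟩
  add_mem' := by
    rintro c d ⟨s, hs, r, hr, hrv⟩ ⟨t, ht, q, hq, hqv⟩
    refine ⟨s * t, mul_ne_zero hs ht, aeval (hD K m) t * r + aeval (hD K m) s * q, ?_, ?_⟩
    · rw [map_add, map_mul, map_mul, iota_aeval, iota_aeval, hr, hq, ← mul_assoc, ← mul_assoc,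
        ← ofD_mul, ← ofD_mul, mul_comm t, mul_add]
    · rw [add_smul, mul_smul, mul_smul, hrv, hqv, smul_zero, smul_zero, add_zero]
  smul_mem' := by
    rintro e c ⟨s, hs, r, hr, hrv⟩
    obtain ⟨v, hv⟩ := (isUnit_ofD hs).exists_left_inv
    obtain ⟨t, ht, q, hq⟩ := exists_ofD_mul_eq_iota m (e * v)
    refine ⟨t, ht, q * r, ?_, by rw [mul_smul, hrv, smul_zero]⟩
    rw [map_mul, hq, hr, smul_eq_mul, mul_assoc, mul_assoc, ← mul_assoc v, hv, one_mul]

section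

variable {m : ℕ} {M : Type*} [AddCommGroup M] [Module (DA K m) M]

theorem iota_mem_annB (hM : IsDTorsionFree K m M) (v : M) (r : DA K m) :
    iota K m r ∈ annB m v ↔ r • v = 0 := by
  constructor
  · rintro ⟨s, hs, q, hq, hqv⟩
    rw [← iota_aeval, ← map_mul] at hq
    rw [iota_injective m hq, mul_smul] at hqv
    exact hM s hs _ hqv
  · intro h
    exact ⟨1, one_ne_zero, r, by rw [← iota_aeval m, map_one, map_one, one_mul], h⟩

theorem not_mul_hD_eq_one (r : DA K m) : r * hD K m ≠ 1 := by
  intro h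
  have h1 : iota K m r * ofD X = 1 := by
    rw [← iota_aeval m X, aeval_X, ← map_mul, h, map_one]
  have h2 := congrArg (fun c : B K => c.coeff 1) h1
  have h3 : (iota K m r).coeff 1 = algebraMap K[X] (RatFunc K) ((toA1x K m r).coeff 1) :=
    coeff_toB (toA1x K m r) 0
  simp only [ofD, SkewMonoidAlgebra.coeff_mul_single_one, one_smul, h3, ← map_mul,
    SkewMonoidAlgebra.coeff_one, Finsupp.single_eq_same] at h2
  rw [← map_one (algebraMap K[X] (RatFunc K))] at h2
  exact not_isUnit_X (IsUnit.of_mul_eq_one_right _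
    (FaithfulSMul.algebraMap_injective K[X] (RatFunc K) h2))

theorem exists_annB_eq (hS : IsSimpleModule (DA K m) M) (hM : IsDTorsionFree K m M) {v : M}
    (hv : v ≠ 0) : ∃ b : B K, Irreducible b ∧ annB m v = Ideal.span {b} := by
  obtain ⟨b, hb⟩ := exists_eq_span_singleton (annB (K := K) m v)
  have hsurj : ∀ {w : M}, w ≠ 0 → ∃ r : DA K m, r • w = v := fun hw =>
    IsSimpleModule.toSpanSingleton_surjective (DA K m) hw v
  have h1 : (1 : B K) ∉ annB m v := by
    rw [← map_one (iota K m), iota_mem_annB hM, one_smul]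
    exact hv
  have hb0 : b ≠ 0 := by
    rintro rfl
    -- If the annihilator were zero, `M` would be free on `v`. Simplicity gives `r h v = v`, so `r h
    -- = 1`, while `h` has no left inverse in `𝒟(A)`.
    have hhv : hD K m • v ≠ 0 := fun h => hv (hM X X_ne_zero v (by rwa [aeval_X]))
    obtain ⟨r, hr⟩ := hsurj hhv
    have h2 : iota K m (r * hD K m - 1) ∈ annB m v := by
      rw [iota_mem_annB hM, sub_smul, mul_smul, hr, one_smul, sub_self]
    rw [hb, Ideal.span_singleton_zero, Ideal.mem_bot] at h2
    have h3 := iota_injective m (h2.trans (map_zero _).symm)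
    exact not_mul_hD_eq_one r (sub_eq_zero.1 h3)
  refine ⟨b, ⟨fun hu => h1 ?_, fun u c huc => ?_⟩, hb⟩
  · obtain ⟨t, ht⟩ := hu.exists_left_inv
    rw [hb]
    exact Ideal.mem_span_singleton'.2 ⟨t, ht⟩
  · have hc0 : c ≠ 0 := by rintro rfl; exact hb0 (by rw [huc, mul_zero])
    -- Here `b = u c`. If `c` kills `v` then `c ∈ Bb` and `u` is a unit; if not, simplicity carries
    -- a multiple of `c v` back to `v`, and `c` gets a left inverse modulo `b = u c`, hence a left
    -- inverse.
    by_cases hc : c ∈ annB m v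
    · left
      rw [hb] at hc
      obtain ⟨t, ht⟩ := Ideal.mem_span_singleton'.1 hc
      have : (t * u - 1) * c = 0 := by rw [sub_mul, mul_assoc, ← huc, ht, one_mul, sub_self]
      exact (isUnit_of_mul_eq_one_B
        (sub_eq_zero.1 ((mul_eq_zero.1 this).resolve_right hc0))).2
    · right
      obtain ⟨s, hs, r, hr⟩ := exists_ofD_mul_eq_iota m c
      have hrv : r • v ≠ 0 := fun h => hc ⟨s, hs, r, hr, h⟩
      obtain ⟨q, hq⟩ := hsurj hrv
      have h2 : iota K m (q * r - 1) ∈ annB m v := by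
        rw [iota_mem_annB hM, sub_smul, mul_smul, hq, one_smul, sub_self]
      rw [hb] at h2
      obtain ⟨t, ht⟩ := Ideal.mem_span_singleton'.1 h2
      refine (isUnit_of_mul_eq_one_B (a := iota K m q * ofD s - t * u) ?_).2
      rw [sub_mul, mul_assoc, mul_assoc, ← huc, ht, map_sub, map_mul, hr, map_one, sub_sub_cancel]

theorem exists_equiv_Mb (hS : IsSimpleModule (DA K m) M) (hM : IsDTorsionFree K m M) :
    ∃ b : B K, IsNormalElt m b ∧ Irreducible b ∧ Nonempty (M ≃ₗ[DA K m] Mb m b) := by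
  have := IsSimpleModule.nontrivial (DA K m) M
  obtain ⟨v, hv⟩ := exists_ne (0 : M)
  obtain ⟨b, hb, hvb⟩ := exists_annB_eq hS hM hv
  have hker : LinearMap.ker (LinearMap.toSpanSingleton (DA K m) M v) = leftIdeal m b := by
    ext r
    rw [LinearMap.mem_ker, LinearMap.toSpanSingleton_apply, mem_leftIdeal, ← hvb,
      iota_mem_annB hM]
  let e₁ : M ≃ₗ[DA K m] Mb m b :=
    ((LinearMap.toSpanSingleton (DA K m) M v).quotKerEquivOfSurjective
      (IsSimpleModule.toSpanSingleton_surjective (DA K m) hv)).symm.trans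
      (Submodule.quotEquivOfEq _ _ hker)
  -- At this stage `b` need not be normal; simplicity of `M_b` comes from `M`.
  have := IsSimpleModule.congr e₁.symm
  obtain ⟨p, q, hp, hq, hn⟩ := exists_isNormalElt m hb
  have hb' : Irreducible (p * b * q) :=
    (irreducible_mul_isUnit hq).2 ((irreducible_isUnit_mul hp).2 hb)
  have := isSimpleModule_Mb hn hb'
  obtain ⟨p', hp'⟩ := hp.exists_left_inv
  obtain ⟨q', hq'⟩ := hq.exists_left_inv
  obtain ⟨e₂⟩ := Mb_nonempty_equiv (m := m) (b := b) (b' := p * b * q) (e := q) hb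
    (fun h => one_notMem_span hb'.not_isUnit (by
      rw [← hq']; exact Ideal.mul_mem_left _ q' h))
    (Ideal.mem_span_singleton'.2 ⟨p', by rw [← mul_assoc, ← mul_assoc, hp', one_mul]⟩)
  exact ⟨_, hn, hb', ⟨e₁.trans e₂⟩⟩

end

end CuspDiff

end

theorem theorem3p9 {K : Type*} [Field K] [CharZero K] (m : ℕ) (hm : 2 ≤ m) :
    -- each `M_b` is a simple `D`-torsion free module
    (∀ b : CuspDiff.B K, CuspDiff.IsNormalElt m b → Irreducible b →
      IsSimpleModule (CuspDiff.DA K m) (CuspDiff.Mb m b) ∧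
        CuspDiff.IsDTorsionFree K m (CuspDiff.Mb m b)) ∧
    -- each simple `D`-torsion free module is isomorphic to some `M_b`
    (∀ (M : Type*) [AddCommGroup M] [Module (CuspDiff.DA K m) M],
      IsSimpleModule (CuspDiff.DA K m) M → CuspDiff.IsDTorsionFree K m M →
      ∃ b : CuspDiff.B K, CuspDiff.IsNormalElt m b ∧ Irreducible b ∧
        Nonempty (M ≃ₗ[CuspDiff.DA K m] CuspDiff.Mb m b)) ∧
    -- `M_b ≅ M_{b'}` if and only if `b` and `b'` are similar
    (∀ b b' : CuspDiff.B K, CuspDiff.IsNormalElt m b → Irreducible b →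
      CuspDiff.IsNormalElt m b' → Irreducible b' →
      (Nonempty (CuspDiff.Mb m b ≃ₗ[CuspDiff.DA K m] CuspDiff.Mb m b') ↔
        CuspDiff.AreSimilar b b')) := by
  refine ⟨fun b hn hb => ⟨CuspDiff.isSimpleModule_Mb hn hb, CuspDiff.isDTorsionFree_Mb m b⟩,
    fun M _ _ hS hM => CuspDiff.exists_equiv_Mb hS hM, fun b b' hn hb hn' hb' => ?_⟩
  have := CuspDiff.isSimpleModule_Mb hn hb
  have := CuspDiff.isSimpleModule_Mb hn' hb'
  exact CuspDiff.nonempty_equiv_iff_areSimilar hb hb'
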